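/- **Setting.** Fix integers $k_1,k_2\ge 2$, a finite alphabet $\mathcal Z$, probability distributions $Q_u$ on $\mathcal Z$ ($u\in\mathcal Z$) with $Q_u(u)>Q_u(v)$ for all $v\neq u$, and a table of nominal ratings $z_{ab}\in\mathcal Z$ ($a\in[k_1]$, $b\in[k_2]$); write $Q_{ab}:=Q_{z_{ab}}$. There are $n$ users and $m$ items, $k_1\mid n$, $k_2\mid m$. A ground truth is $(\sigma,\tau,\mathsf N)\in\Xi$, where $\Xi$ is the set of triples in which $\sigma:[n]\to[k_1]$ has all clusters of size $n/k_1$, $\tau:[m]\to[k_2]$ has all clusters of size $m/k_2$, and $\mathsf N\in\mathcal Z^{n\times m}$ satisfies $\mathsf N_{ij}=\mathsf N_{i'j'}$ whenever $\sigma(i)=\sigma(i')$ and $\tau(j)=\tau(j')$. Let $\Xi_z\subseteq\Xi$ be the set of those triples with $\mathsf N_{ij}=z_{\sigma(i)\tau(j)}$. Given $(\sigma,\tau,\mathsf N)$ one observes, all independent: a matrix $\mathsf U$ whose entry $\mathsf U_{ij}$ is erased with probability $1-p$ and is otherwise drawn from $Q_{\mathsf N_{ij}}$; a graph $G_1$ on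 the users in which each pair is joined with probability $\alpha_1$ if both lie in the same cluster of $\sigma$ and $\beta_1$ otherwise; and a graph $G_2$ on the items, likewise with $\tau,\alpha_2,\beta_2$. An estimator $\phi$ maps $(\mathsf U,G_1,G_2)$ to $(\widehat\sigma,\widehat\tau,\widehat{\mathsf N})$; it errs unless $\widehat\sigma=\pi\circ\sigma$ and $\widehat\tau=\pi'\circ\tau$ for some permutations $\pi,\pi'$ of the labels, and $\widehat{\mathsf N}=\mathsf N$. For $\Theta\subseteq\Xi$ let $P_{\rm err}(\phi;\Theta)$ be the maximum over $(\sigma,\tau,\mathsf N)\in\Theta$ of the probability that $\phi$ errs, and $P_{\rm err}(\phi):=P_{\rm err}(\phi;\Xi)$. Let $I_1:=n(\sqrt{\alpha_1}-\sqrt{\beta_1})^2/\log n$, $I_2:=m(\sqrt{\alpha_2}-\sqrt{\beta_2})^2/\log m$, $H^2(P,P'):=1-\sum_{v\in\mathcal Z}\sqrt{P(v)P'(v)}$, $$d_{\mathcal U}:=\min_{a\ne a'}\sum_{b\in[k_2]}H^2(Q_{ab},Q_{a'b}),\qquad d_{\mathcal I}:=\min_{b\ne b'}\sum_{a\in[k_1]}H^2(Q_{ab},Q_{ab'}),$$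 and assume $d_{\mathcal U},d_{\mathcal I}>0$. **Theorem (strong converse).** Consider a sequence of such models along which $n\to\infty$, $m=\omega(\log n)$, $n=\omega(\log m)$, and $\alpha_1,\beta_1,\alpha_2,\beta_2\to0$, where $m,p,\alpha_1,\beta_1,\alpha_2,\beta_2$ may vary along the sequence while $k_1,k_2,\mathcal Z,Q,z$ are fixed. Let $\epsilon>0$, and suppose that, for all sufficiently large indices of the sequence, $$mnp<\max\left\{\frac{\left[\frac{1-\epsilon}{2}-\frac{I_1}{k_1}\right]n\log n}{d_{\mathcal U}/k_2},\ \frac{\left[\frac{1-\epsilon}{2}-\frac{I_2}{k_2}\right]m\log m}{d_{\mathcal I}/k_1}\right\}.$$ Then every sequence of estimators $\phi$ satisfies $P_{\rm err}(\phi)\to1$, and moreover $P_{\rm err}(\phi;\Xi_z)\to1$, i.e. the maximum may be restricted to ground truths whose nominal matrix is built from the given table $z$. -/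

import Mathlib

open Filter Topology Asymptotics

noncomputable section

namespace TwoGraphMC

/-- The observation `(U, G₁, G₂)`: a rating matrix over the alphabet `Z` in which `none` is the
erasure symbol, a graph on the `n` users and a graph on the `m` items. -/
abbrev Obs (n m : ℕ) (Z : Type*) : Type _ :=
  (Fin n → Fin m → Option Z) × SimpleGraph (Fin n) × SimpleGraph (Fin m)

/-- A triple `(σ, τ, N)`: user labels, item labels, rating matrix. Used both for the ground truth
and for the output of an estimator (whose labels need not be balanced). -/
structure Triple (n m k₁ k₂ : ℕ) (Z : Type*) where
  /-- user labels -/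
  σ : Fin n → Fin k₁
  /-- item labels -/
  τ : Fin m → Fin k₂
  /-- nominal matrix -/
  N : Fin n → Fin m → Z

/-- An estimator: any map from observations to triples. -/
abbrev Estimator (n m k₁ k₂ : ℕ) (Z : Type*) : Type _ := Obs n m Z → Triple n m k₁ k₂ Z

open Classical in
/-- All `k` clusters of the labelling have the same size `n / k`. -/
def Balanced {n k : ℕ} (c : Fin n → Fin k) : Prop :=
  ∀ a : Fin k, k * (Finset.univ.filter fun i => c i = a).card = n

/-- The parameter space `Ξ` of the symmetric setting: both labellings are balanced and `N` is
constant on every block (user cluster) × (item cluster). -/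
def paramSpace (n m k₁ k₂ : ℕ) (Z : Type*) : Set (Triple n m k₁ k₂ Z) :=
  {ξ | Balanced ξ.σ ∧ Balanced ξ.τ ∧
    ∀ i i' j j', ξ.σ i = ξ.σ i' → ξ.τ j = ξ.τ j' → ξ.N i j = ξ.N i' j'}

/-- The triples of `Ξ` whose nominal matrix is built from the table `z` of nominal ratings,
`N i j = z (σ i) (τ j)`. -/
def paramSpaceOf (n m : ℕ) {k₁ k₂ : ℕ} {Z : Type*} (z : Fin k₁ → Fin k₂ → Z) :
    Set (Triple n m k₁ k₂ Z) :=
  {ξ | ξ ∈ paramSpace n m k₁ k₂ Z ∧ ∀ i j, ξ.N i j = z (ξ.σ i) (ξ.τ j)}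

/-- Law of one entry of the sub-sampled matrix: erased with probability `1 - p`, otherwise drawn
from the distribution `q`. -/
def entryLaw {Z : Type*} (p : ℝ) (q : Z → ℝ) : Option Z → ℝ
  | none => 1 - p
  | some v => p * q v

open Classical in
/-- Probability of the graph `G` under the symmetric stochastic block model with labels `c`:
every pair `i < i'` is joined independently, with probability `α` inside a cluster and `β` across
clusters. -/
def sbmLaw {n k : ℕ} (α β : ℝ) (c : Fin n → Fin k) (G : SimpleGraph (Fin n)) : ℝ :=
  ∏ i : Fin n, ∏ i' ∈ Finset.Ioi i,
    if G.Adj i i' then (if c i = c i' then α else β) else 1 - (if c i = c i' then α else β)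

/-- Probability of the observation `(U, G₁, G₂)` when the ground truth is `ξ = (σ, τ, N)`: the
three parts are independent, and so are the entries of `U`. -/
def obsLaw {n m k₁ k₂ : ℕ} {Z : Type*} (Q : Z → Z → ℝ) (p α₁ β₁ α₂ β₂ : ℝ)
    (ξ : Triple n m k₁ k₂ Z) (x : Obs n m Z) : ℝ :=
  (∏ i : Fin n, ∏ j : Fin m, entryLaw p (Q (ξ.N i j)) (x.1 i j)) *
    sbmLaw α₁ β₁ ξ.σ x.2.1 * sbmLaw α₂ β₂ ξ.τ x.2.2

open Classical in
/-- Misclassification proportion, up to a permutation of the labels. -/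
def misclass {n k : ℕ} (c' c : Fin n → Fin k) : ℝ :=
  ⨅ π : Equiv.Perm (Fin k),
    (1 / (n : ℝ)) * ((Finset.univ.filter fun i => c' i ≠ π (c i)).card : ℝ)

/-- The output `ξ'` is an error for the ground truth `ξ`. -/
def IsError {n m k₁ k₂ : ℕ} {Z : Type*} (ξ ξ' : Triple n m k₁ k₂ Z) : Prop :=
  misclass ξ'.σ ξ.σ ≠ 0 ∨ misclass ξ'.τ ξ.τ ≠ 0 ∨ ξ'.N ≠ ξ.N

open Classical in
/-- Error probability of the estimator `φ` when the ground truth is `ξ`. -/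
def errorProb {n m k₁ k₂ : ℕ} {Z : Type*} [Fintype Z] (Q : Z → Z → ℝ) (p α₁ β₁ α₂ β₂ : ℝ)
    (φ : Estimator n m k₁ k₂ Z) (ξ : Triple n m k₁ k₂ Z) : ℝ :=
  ∑ x : Obs n m Z, if IsError ξ (φ x) then obsLaw Q p α₁ β₁ α₂ β₂ ξ x else 0

/-- Maximum error probability of the estimator `φ` over the set `Θ` of ground truths. -/
def maxErrorProb {n m k₁ k₂ : ℕ} {Z : Type*} [Fintype Z] (Θ : Set (Triple n m k₁ k₂ Z))
    (Q : Z → Z → ℝ) (p α₁ β₁ α₂ β₂ : ℝ) (φ : Estimator n m k₁ k₂ Z) : ℝ :=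
  ⨆ ξ : Θ, errorProb Q p α₁ β₁ α₂ β₂ φ ξ

/-- Quality of a graph on `n` nodes: `I = n (√α - √β)² / log n`. -/
def graphQuality (n : ℕ) (α β : ℝ) : ℝ :=
  (n : ℝ) * (√α - √β) ^ 2 / Real.log n

/-- Squared Hellinger distance of two distributions on a finite set. -/
def hellingerSq {Z : Type*} [Fintype Z] (P P' : Z → ℝ) : ℝ :=
  1 - ∑ v, √(P v * P' v)

/-- Minimal discrepancy `d_𝒰` over pairs of distinct user clusters. -/
def minUserDisc {k₁ k₂ : ℕ} {Z : Type*} [Fintype Z] (Q : Z → Z → ℝ)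
    (z : Fin k₁ → Fin k₂ → Z) : ℝ :=
  ⨅ a : {a : Fin k₁ × Fin k₁ // a.1 ≠ a.2},
    ∑ b : Fin k₂, hellingerSq (Q (z a.1.1 b)) (Q (z a.1.2 b))

/-- Minimal discrepancy `d_ℐ` over pairs of distinct item clusters. -/
def minItemDisc {k₁ k₂ : ℕ} {Z : Type*} [Fintype Z] (Q : Z → Z → ℝ)
    (z : Fin k₁ → Fin k₂ → Z) : ℝ :=
  ⨅ b : {b : Fin k₂ × Fin k₂ // b.1 ≠ b.2},
    ∑ a : Fin k₁, hellingerSq (Q (z a b.1.1)) (Q (z a b.1.2))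

end TwoGraphMC

end

/-!
Below the threshold of the users, one exchange of two users between the clusters `a` and `a'` that
attain `d_𝒰` has Bhattacharyya affinity at least `n ^ (-(1 - ε / 2))`: the two rows of ratings
contribute `exp (-2 p (m / k₂) d_𝒰)`, the affected pairs of the graph
`exp (-2 (n / k₁) (√α₁ - √β₁) ^ 2)`, both up to `1 + o(1)` in the exponent. The converse is a second
moment argument built on affinities alone.

The nominal matrix is built from `z`, the item labels are fixed, and the user labels are varied on
the `2N = 2 n / k₁` nodes of the two clusters: each `N`-subset `T` of them gives a balanced
labelling with law `P_T`. The affinity of `P_T` and `P_T'` is a function `F` of the size of the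
symmetric difference only (`prod_pairAffinity_relabel`, `prod_rows_relabel`). The alternatives to
`T` are its `N ^ 2` exchanges `T_p`. The sum of `√(P_{T_p} / P_T)` over `p` has mean `N ^ 2 F(2)` and
second moment at most `N ^ 2 + 2 N ^ 3 F(2) + N ^ 4 F(4)` under `P_T`, so it concentrates when
`N F(2) → ∞` and `F(4) / F(2) ^ 2 → 1`; then, by Cauchy–Schwarz, the sum of the likelihood ratios is
at least of order `(N F(2)) ^ 2` with high probability. Since each observation is decoded to at most
one `T`, whose exchanges are distinct members of the family, the average success probability is at
most of order `(N F(2)) ^ (-2)` plus the variance term (`sum_success_le`). Here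
`F(4) / F(2) ^ 2 = ρ ^ (-8)`, where `ρ → 1` is the affinity of one edge, because two disjoint
exchanges share four pairs of nodes.

Distinct `T` have distinct nominal matrices, as `d_𝒰 > 0` makes the rows of `z` for `a` and `a'`
different; so only failures to recover `N` are counted as errors, and permutations of the labels
play no role. The threshold of the items is treated in the same way with columns in place of rows.
-/

namespace TwoGraphMC

/-! ### A second moment bound through affinities -/

/-- Bhattacharyya affinity `∑ √(P P')` of two weight functions on a finite set. -/
noncomputable def affinity {X : Type*} [Fintype X] (P P' : X → ℝ) : ℝ :=
  ∑ x, √(P x * P' x)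

/-- Success at a ground truth with law `P` is controlled by the alternatives `R i`, `i ∈ I`: on the
event `B`, the mass of `P` is at most the mass of the alternatives up to the factor `2 #I / μ²`,
plus a variance term. No absolute continuity is needed, because `√P` and `∑ √(R i)` are compared
rather than likelihood ratios. -/
theorem sq_mul_sum_le_of_affinity {X ι : Type*} [Fintype X] (P : X → ℝ) (R : ι → X → ℝ)
    (I : Finset ι) (B : Finset X) (hP : ∀ x, 0 ≤ P x) (hP1 : ∑ x, P x = 1)
    (hR : ∀ i ∈ I, ∀ x, 0 ≤ R i x) {μ M : ℝ}
    (hμ : ∑ i ∈ I, affinity P (R i) = μ)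
    (hM : ∑ i ∈ I, ∑ j ∈ I, affinity (R i) (R j) ≤ M) :
    μ ^ 2 * ∑ x ∈ B, P x ≤ 2 * (M - μ ^ 2) + 2 * I.card * ∑ x ∈ B, ∑ i ∈ I, R i x := by
  set w : X → ℝ := fun x => ∑ i ∈ I, √(R i x) with hw
  -- either `w` is close to `μ √P`, or `w ^ 2` is a large part of `μ ^ 2 P`
  have hpt : ∀ x, μ ^ 2 * P x ≤ 2 * (w x - μ * √(P x)) ^ 2 + 2 * I.card * ∑ i ∈ I, R i x := by
    intro x
    have h1 : w x ^ 2 ≤ I.card * ∑ i ∈ I, R i x := by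
      refine sq_sum_le_card_mul_sum_sq.trans_eq ?_
      congr 1
      exact Finset.sum_congr rfl fun i hi => Real.sq_sqrt (hR i hi x)
    have h2 : √(P x) ^ 2 = P x := Real.sq_sqrt (hP x)
    have h3 : μ ^ 2 * P x = (μ * √(P x)) ^ 2 := by rw [mul_pow, h2]
    rw [h3]
    nlinarith [sq_nonneg (2 * w x - μ * √(P x))]
  have hws : ∑ x, w x * √(P x) = μ := by
    rw [← hμ]
    simp only [hw, affinity, Finset.sum_mul]
    rw [Finset.sum_comm]
    refine Finset.sum_congr rfl fun i hi => Finset.sum_congr rfl fun x _ => ?_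
    rw [Real.sqrt_mul (hP x), mul_comm]
  have hww : ∑ x, w x ^ 2 ≤ M := by
    refine le_of_eq_of_le ?_ hM
    simp only [hw, affinity, sq, Finset.sum_mul_sum]
    rw [Finset.sum_comm]
    refine Finset.sum_congr rfl fun i hi => ?_
    rw [Finset.sum_comm]
    refine Finset.sum_congr rfl fun j _ => Finset.sum_congr rfl fun x _ => ?_
    rw [Real.sqrt_mul (hR i hi x)]
  have hvar : ∑ x ∈ B, (w x - μ * √(P x)) ^ 2 ≤ M - μ ^ 2 := by
    calc ∑ x ∈ B, (w x - μ * √(P x)) ^ 2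
        ≤ ∑ x, (w x - μ * √(P x)) ^ 2 :=
          Finset.sum_le_sum_of_subset_of_nonneg (Finset.subset_univ _) fun _ _ _ => sq_nonneg _
      _ = ∑ x, w x ^ 2 - 2 * μ * ∑ x, w x * √(P x) + μ ^ 2 * ∑ x, P x := by
          rw [Finset.mul_sum, Finset.mul_sum, ← Finset.sum_sub_distrib, ← Finset.sum_add_distrib]
          refine Finset.sum_congr rfl fun x _ => ?_
          linear_combination μ ^ 2 * Real.sq_sqrt (hP x)
      _ ≤ M - μ ^ 2 := by rw [hws, hP1]; linarith
  calc μ ^ 2 * ∑ x ∈ B, P x = ∑ x ∈ B, μ ^ 2 * P x := Finset.mul_sum ..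
    _ ≤ ∑ x ∈ B, (2 * (w x - μ * √(P x)) ^ 2 + 2 * I.card * ∑ i ∈ I, R i x) :=
        Finset.sum_le_sum fun x _ => hpt x
    _ = 2 * ∑ x ∈ B, (w x - μ * √(P x)) ^ 2 + 2 * I.card * ∑ x ∈ B, ∑ i ∈ I, R i x := by
        rw [Finset.sum_add_distrib, Finset.mul_sum, Finset.mul_sum]
    _ ≤ _ := by linarith

section Exchange

variable {ι : Type*} [DecidableEq ι]

/-- The set obtained from `T` by exchanging its element `p.1` for `p.2`. -/
def exchange (T : Finset ι) (p : ι × ι) : Finset ι := insert p.2 (T.erase p.1)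

theorem exchange_mem_powersetCard {S T : Finset ι} {N : ℕ} (hT : T ∈ S.powersetCard N) {p : ι × ι}
    (hp : p ∈ T ×ˢ (S \ T)) : exchange T p ∈ S.powersetCard N := by
  obtain ⟨hTS, hTN⟩ := Finset.mem_powersetCard.1 hT
  obtain ⟨h1, h2⟩ := Finset.mem_product.1 hp
  obtain ⟨h2, h3⟩ := Finset.mem_sdiff.1 h2
  refine Finset.mem_powersetCard.2 ⟨?_, ?_⟩
  · exact Finset.insert_subset h2 ((Finset.erase_subset _ _).trans hTS)
  · rw [exchange, Finset.card_insert_of_notMem (fun h => h3 (Finset.mem_of_mem_erase h)),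
      Finset.card_erase_add_one h1, hTN]

theorem mem_exchange {T : Finset ι} {p : ι × ι} {x : ι} :
    x ∈ exchange T p ↔ x = p.2 ∨ (x ≠ p.1 ∧ x ∈ T) := by
  simp [exchange]

theorem exchange_injOn (S T : Finset ι) :
    Set.InjOn (exchange T) (T ×ˢ (S \ T) : Finset (ι × ι)) := by
  rintro ⟨i, i'⟩ hp ⟨j, j'⟩ hq h
  simp only [Finset.coe_product, Set.mem_prod, Finset.mem_coe, Finset.mem_sdiff] at hp hq
  have key : ∀ x, x = i' ∨ (x ≠ i ∧ x ∈ T) ↔ x = j' ∨ (x ≠ j ∧ x ∈ T) := fun x => by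
    simpa [mem_exchange] using Finset.ext_iff.1 h x
  have h1 := key i
  have h2 := key i'
  grind

theorem symmDiff_exchange_self {S T : Finset ι} {p : ι × ι} (hp : p ∈ T ×ˢ (S \ T)) :
    (symmDiff T (exchange T p)).card = 2 := by
  obtain ⟨i, i'⟩ := p
  simp only [Finset.mem_product, Finset.mem_sdiff] at hp
  have : symmDiff T (exchange T (i, i')) = {i, i'} := by
    ext x; simp only [Finset.mem_symmDiff, mem_exchange, Finset.mem_insert, Finset.mem_singleton]
    grind
  rw [this, Finset.card_pair]
  grind

theorem symmDiff_exchange_of_fst_eq {S T : Finset ι} {i i' j' : ι} (hp : (i, i') ∈ T ×ˢ (S \ T))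
    (hq : (i, j') ∈ T ×ˢ (S \ T)) (h : i' ≠ j') :
    (symmDiff (exchange T (i, i')) (exchange T (i, j'))).card = 2 := by
  simp only [Finset.mem_product, Finset.mem_sdiff] at hp hq
  have : symmDiff (exchange T (i, i')) (exchange T (i, j')) = {i', j'} := by
    ext x; simp only [Finset.mem_symmDiff, mem_exchange, Finset.mem_insert, Finset.mem_singleton]
    grind
  rw [this, Finset.card_pair h]

theorem symmDiff_exchange_of_snd_eq {S T : Finset ι} {i j i' : ι} (hp : (i, i') ∈ T ×ˢ (S \ T))
    (hq : (j, i') ∈ T ×ˢ (S \ T)) (h : i ≠ j) :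
    (symmDiff (exchange T (i, i')) (exchange T (j, i'))).card = 2 := by
  simp only [Finset.mem_product, Finset.mem_sdiff] at hp hq
  have : symmDiff (exchange T (i, i')) (exchange T (j, i')) = {i, j} := by
    ext x; simp only [Finset.mem_symmDiff, mem_exchange, Finset.mem_insert, Finset.mem_singleton]
    grind
  rw [this, Finset.card_pair h]

theorem symmDiff_exchange_of_ne {S T : Finset ι} {i j i' j' : ι} (hp : (i, i') ∈ T ×ˢ (S \ T))
    (hq : (j, j') ∈ T ×ˢ (S \ T)) (h : i ≠ j) (h' : i' ≠ j') :
    (symmDiff (exchange T (i, i')) (exchange T (j, j'))).card = 4 := by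
  simp only [Finset.mem_product, Finset.mem_sdiff] at hp hq
  have : symmDiff (exchange T (i, i')) (exchange T (j, j')) = {i, j, i', j'} := by
    ext x; simp only [Finset.mem_symmDiff, mem_exchange, Finset.mem_insert, Finset.mem_singleton]
    grind
  rw [this]
  have h1 : i ≠ i' := by grind
  have h2 : i ≠ j' := by grind
  have h3 : j ≠ i' := by grind
  have h4 : j ≠ j' := by grind
  rw [Finset.card_insert_of_notMem (by simp [*]), Finset.card_insert_of_notMem (by simp [*]),
    Finset.card_pair h']

/-- Second moment of the exchange sum: if the affinity of two laws of the family depends only on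
the size of the symmetric difference, the pairs of exchanges split into equal ones, ones sharing
an element, and disjoint ones. -/
theorem sum_affinity_exchange_le {X : Type*} [Fintype X] {S T : Finset ι} {N : ℕ}
    (hS : S.card = 2 * N) (hT : T ∈ S.powersetCard N) (P : Finset ι → X → ℝ) (F : ℕ → ℝ)
    (hF : ∀ t, 0 ≤ F t) (hF0 : F 0 = 1)
    (hPF : ∀ T ∈ S.powersetCard N, ∀ T' ∈ S.powersetCard N,
      affinity (P T) (P T') = F (symmDiff T T').card) :
    ∑ p ∈ T ×ˢ (S \ T), ∑ q ∈ T ×ˢ (S \ T), affinity (P (exchange T p)) (P (exchange T q)) ≤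
      (N : ℝ) ^ 2 + 2 * N ^ 3 * F 2 + N ^ 4 * F 4 := by
  obtain ⟨hTS, hTN⟩ := Finset.mem_powersetCard.1 hT
  have hSN : (S \ T).card = N := by rw [Finset.card_sdiff_of_subset hTS]; omega
  calc _ ≤ ∑ p ∈ T ×ˢ (S \ T), ∑ q ∈ T ×ˢ (S \ T),
        ((if p.1 = q.1 then if p.2 = q.2 then 1 else 0 else 0) + (if p.1 = q.1 then F 2 else 0) +
          (if p.2 = q.2 then F 2 else 0) + F 4) := by
        refine Finset.sum_le_sum fun p hp => Finset.sum_le_sum fun q hq => ?_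
        rw [hPF _ (exchange_mem_powersetCard hT hp) _ (exchange_mem_powersetCard hT hq)]
        obtain ⟨i, i'⟩ := p
        obtain ⟨j, j'⟩ := q
        have h2 := hF 2
        have h4 := hF 4
        by_cases h : i = j <;> by_cases h' : i' = j'
        · subst h h'
          simp [hF0]; linarith
        · subst h
          rw [symmDiff_exchange_of_fst_eq hp hq h']
          simp [h', h4]
        · subst h'
          rw [symmDiff_exchange_of_snd_eq hp hq h]
          simp [h, h4]
        · rw [symmDiff_exchange_of_ne hp hq h h']
          simp [h, h']
    _ = _ := by
        have inner : ∀ p ∈ T ×ˢ (S \ T), ∑ q ∈ T ×ˢ (S \ T),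
            ((if p.1 = q.1 then if p.2 = q.2 then 1 else 0 else 0) +
              (if p.1 = q.1 then F 2 else 0) + (if p.2 = q.2 then F 2 else 0) + F 4) =
            1 + 2 * N * F 2 + N ^ 2 * F 4 := by
          intro p hp
          obtain ⟨h1, h2⟩ := Finset.mem_product.1 hp
          have e1 : ∀ v : ℝ, ∑ x ∈ T, (if p.1 = x then v else 0) = v := fun v => by simp [h1]
          have e2 : ∀ v : ℝ, ∑ x ∈ S \ T, (if p.2 = x then v else 0) = v := fun v => by
            rw [Finset.sum_ite_eq, if_pos h2]
          have e3 : ∀ x, ∑ y ∈ S \ T, (if p.1 = x then if p.2 = y then (1 : ℝ) else 0 else 0) =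
              if p.1 = x then 1 else 0 := fun x => by
            split_ifs
            · exact e2 1
            · exact Finset.sum_const_zero
          have e4 : ∀ x, ∑ y ∈ S \ T, (if p.1 = x then F 2 else 0) =
              if p.1 = x then N * F 2 else 0 := fun x => by
            rw [Finset.sum_const, hSN, nsmul_eq_mul, mul_ite, mul_zero]
          simp only [Finset.sum_add_distrib, Finset.sum_product, e4, e3, e2, e1]
          simp only [Finset.sum_const, hTN, hSN, nsmul_eq_mul]
          ring
        rw [Finset.sum_congr rfl inner, Finset.sum_const, Finset.card_product, hTN, hSN,
          nsmul_eq_mul]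
        push_cast
        ring

/-- Converse for a family of laws indexed by the `N`-subsets of a `2N`-set whose pairwise
affinities `F t` depend only on the size `t` of the symmetric difference: the total success
probability of any decoder `φ` is a small fraction of the number of hypotheses as soon as
`N * F 2` is large and `F 4` is close to `F 2 ^ 2`. -/
theorem sum_success_le {X Y : Type*} [Fintype X] [DecidableEq Y] {S : Finset ι} {N : ℕ}
    (hN : 0 < N) (hS : S.card = 2 * N) (P : Finset ι → X → ℝ) (hP : ∀ T x, 0 ≤ P T x)
    (hP1 : ∀ T, ∑ x, P T x = 1) (F : ℕ → ℝ) (hF : ∀ t, 0 ≤ F t) (hF0 : F 0 = 1) (hF2 : 0 < F 2)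
    (hPF : ∀ T ∈ S.powersetCard N, ∀ T' ∈ S.powersetCard N,
      affinity (P T) (P T') = F (symmDiff T T').card)
    (code : Finset ι → Y) (hcode : Set.InjOn code (S.powersetCard N : Finset (Finset ι)))
    (φ : X → Y) :
    ∑ T ∈ S.powersetCard N, ∑ x, (if φ x = code T then P T x else 0) ≤
      (S.powersetCard N).card *
        (4 / (N * F 2) ^ 2 + 4 / (N * F 2) + 2 * (F 4 / F 2 ^ 2 - 1)) := by
  set Θ := S.powersetCard N with hΘ
  have hN' : (0 : ℝ) < N := by exact_mod_cast hN
  set μ : ℝ := N ^ 2 * F 2 with hμ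
  set M : ℝ := (N : ℝ) ^ 2 + 2 * N ^ 3 * F 2 + N ^ 4 * F 4 with hM
  have hcard : ∀ T ∈ Θ, (T ×ˢ (S \ T)).card = N ^ 2 := by
    intro T hT
    obtain ⟨hTS, hTN⟩ := Finset.mem_powersetCard.1 hT
    have hSN : (S \ T).card = N := by rw [Finset.card_sdiff_of_subset hTS]; omega
    rw [Finset.card_product, hTN, hSN, sq]
  have hone : ∀ T ∈ Θ, μ ^ 2 * ∑ x, (if φ x = code T then P T x else 0) ≤
      2 * (M - μ ^ 2) + 2 * N ^ 2 *
        ∑ x, if φ x = code T then ∑ p ∈ T ×ˢ (S \ T), P (exchange T p) x else 0 := by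
    intro T hT
    have := sq_mul_sum_le_of_affinity (P T) (fun p => P (exchange T p)) (T ×ˢ (S \ T))
      (Finset.univ.filter fun x => φ x = code T) (hP T) (hP1 T) (fun p _ x => hP _ x) (μ := μ)
      (M := M) ?_ (sum_affinity_exchange_le hS hT P F hF hF0 hPF)
    · rw [hcard T hT] at this
      simpa [Finset.sum_filter] using this
    · rw [Finset.sum_congr rfl fun p hp => by
        rw [hPF T hT _ (exchange_mem_powersetCard hT hp), symmDiff_exchange_self hp]]
      rw [Finset.sum_const, hcard T hT, hμ]
      simp
  -- every observation is decoded to at most one hypothesis, whose exchanges are distinct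
  have htot : ∑ T ∈ Θ, ∑ x, (if φ x = code T then ∑ p ∈ T ×ˢ (S \ T), P (exchange T p) x else 0)
      ≤ Θ.card := by
    rw [Finset.sum_comm]
    calc _ ≤ ∑ x, ∑ T ∈ Θ, P T x := by
          refine Finset.sum_le_sum fun x _ => ?_
          by_cases h : ∃ T ∈ Θ, φ x = code T
          · obtain ⟨T, hT, hx⟩ := h
            rw [Finset.sum_eq_single_of_mem T hT, if_pos hx]
            · rw [← Finset.sum_image (f := fun T => P T x) (exchange_injOn S T)]
              refine Finset.sum_le_sum_of_subset_of_nonneg ?_ fun _ _ _ => hP _ _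
              intro T' hT'
              obtain ⟨p, hp, rfl⟩ := Finset.mem_image.1 hT'
              exact exchange_mem_powersetCard hT hp
            · intro T' hT' hne
              refine if_neg fun h => hne ?_
              exact hcode hT' hT (h.symm.trans hx)
          · push Not at h
            rw [Finset.sum_eq_zero fun T hT => if_neg (h T hT)]
            exact Finset.sum_nonneg fun T _ => hP T x
      _ = Θ.card := by
          rw [Finset.sum_comm, Finset.sum_congr rfl fun T _ => hP1 T]
          simp
  have hμ0 : 0 < μ := by positivity
  have hsum : μ ^ 2 * ∑ T ∈ Θ, ∑ x, (if φ x = code T then P T x else 0) ≤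
      Θ.card * (2 * (M - μ ^ 2) + 2 * N ^ 2) := by
    rw [Finset.mul_sum]
    refine (Finset.sum_le_sum hone).trans ?_
    rw [Finset.sum_add_distrib, ← Finset.mul_sum (a := 2 * (N : ℝ) ^ 2), Finset.sum_const,
      nsmul_eq_mul]
    have : (0 : ℝ) ≤ 2 * N ^ 2 := by positivity
    nlinarith [mul_le_mul_of_nonneg_left htot this]
  refine le_of_mul_le_mul_left (hsum.trans_eq ?_) (by positivity : 0 < μ ^ 2)
  rw [hM, hμ]
  field_simp
  ring

end Exchange

/-! ### Affinities of the observation laws -/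

theorem affinity_self {X : Type*} [Fintype X] {P : X → ℝ} (hP : ∀ x, 0 ≤ P x) :
    affinity P P = ∑ x, P x :=
  Finset.sum_congr rfl fun x _ => Real.sqrt_mul_self (hP x)

theorem affinity_nonneg {X : Type*} [Fintype X] (P P' : X → ℝ) : 0 ≤ affinity P P' :=
  Finset.sum_nonneg fun _ _ => Real.sqrt_nonneg _

theorem affinity_le_one {X : Type*} [Fintype X] {P P' : X → ℝ} (hP : P ∈ stdSimplex ℝ X)
    (hP' : P' ∈ stdSimplex ℝ X) : affinity P P' ≤ 1 := by
  have h : ∀ x, √(P x * P' x) ≤ P x / 2 + P' x / 2 := fun x => by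
    have := hP.1 x
    have := hP'.1 x
    refine Real.sqrt_le_iff.2 ⟨by positivity, by nlinarith [sq_nonneg (P x - P' x)]⟩
  refine (Finset.sum_le_sum fun x _ => h x).trans ?_
  rw [Finset.sum_add_distrib, ← Finset.sum_div, ← Finset.sum_div, hP.2, hP'.2]
  norm_num

theorem hellingerSq_eq {Z : Type*} [Fintype Z] (P P' : Z → ℝ) :
    hellingerSq P P' = 1 - affinity P P' := rfl

/-- A product weight over the pairs `i < i'` sums over all graphs to the product of the sums over
the two states of each pair. -/
theorem sum_simpleGraph_prod {n : ℕ} (g : Fin n → Fin n → Prop → ℝ) :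
    ∑ G : SimpleGraph (Fin n), ∏ i, ∏ j ∈ Finset.Ioi i, g i j (G.Adj i j) =
      ∏ i, ∏ j ∈ Finset.Ioi i, (g i j True + g i j False) := by
  classical
  set E : Finset (Σ _ : Fin n, Fin n) := Finset.univ.sigma fun i => Finset.Ioi i with hE
  have hmem : ∀ e : Σ _ : Fin n, Fin n, e ∈ E ↔ e.1 < e.2 := by simp [hE]
  rw [Finset.prod_sigma', Finset.prod_add]
  refine Finset.sum_bij' (fun G _ => E.filter fun e => G.Adj e.1 e.2)
    (fun A _ => SimpleGraph.fromRel fun i j => i < j ∧ (⟨i, j⟩ : Σ _ : Fin n, Fin n) ∈ A)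
    (fun G _ => Finset.mem_powerset.2 (Finset.filter_subset _ _)) (fun _ _ => Finset.mem_univ _)
    ?_ ?_ ?_
  · intro G _
    ext i j
    simp only [SimpleGraph.fromRel_adj, Finset.mem_filter, hmem]
    constructor
    · rintro ⟨-, h | h⟩
      · exact h.2.2
      · exact h.2.2.symm
    · intro h
      refine ⟨h.ne, ?_⟩
      rcases lt_or_gt_of_ne h.ne with h' | h'
      · exact Or.inl ⟨h', h', h⟩
      · exact Or.inr ⟨h', h', h.symm⟩
  · intro A hA
    ext ⟨i, j⟩
    have hA' := Finset.mem_powerset.1 hA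
    simp only [SimpleGraph.fromRel_adj, Finset.mem_filter, hmem]
    constructor
    · rintro ⟨h, -, h' | h'⟩
      · exact h'.2
      · exact absurd h (not_lt.2 h'.1.le)
    · intro h
      have hlt : i < j := (hmem _).1 (hA' h)
      exact ⟨hlt, hlt.ne, Or.inl ⟨hlt, h⟩⟩
  · intro G _
    rw [Finset.prod_sigma', ← Finset.prod_filter_mul_prod_filter_not E fun e => G.Adj e.1 e.2,
      ← Finset.filter_not]
    congr 1
    · exact Finset.prod_congr rfl fun e he => by simp [(Finset.mem_filter.1 he).2]
    · exact Finset.prod_congr rfl fun e he => by simp [(Finset.mem_filter.1 he).2]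

/-- Affinity of the Bernoulli laws with parameters `α` and `β`. -/
noncomputable def edgeAffinity (α β : ℝ) : ℝ := √(α * β) + √((1 - α) * (1 - β))

theorem edgeAffinity_comm (α β : ℝ) : edgeAffinity α β = edgeAffinity β α := by
  simp [edgeAffinity, mul_comm]

theorem edgeAffinity_self {α : ℝ} (hα : α ∈ Set.Icc (0 : ℝ) 1) : edgeAffinity α α = 1 := by
  rw [edgeAffinity, Real.sqrt_mul_self hα.1, Real.sqrt_mul_self (by linarith [hα.2])]
  ring

open Classical in
/-- The factor by which the pair `i, i'` enters the affinity of two block models: it is `1` unless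
exactly one of the labellings joins the two nodes. -/
noncomputable def pairAffinity {n k : ℕ} (α β : ℝ) (c c' : Fin n → Fin k) (i i' : Fin n) : ℝ :=
  if (c i = c i' ↔ c' i = c' i') then 1 else edgeAffinity α β

theorem sbmLaw_nonneg {n k : ℕ} {α β : ℝ} (hα : α ∈ Set.Icc (0 : ℝ) 1)
    (hβ : β ∈ Set.Icc (0 : ℝ) 1) (c : Fin n → Fin k) (G : SimpleGraph (Fin n)) :
    0 ≤ sbmLaw α β c G := by
  obtain ⟨h1, h2⟩ := hα
  obtain ⟨h3, h4⟩ := hβ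
  refine Finset.prod_nonneg fun i _ => Finset.prod_nonneg fun j _ => ?_
  split_ifs <;> linarith

theorem affinity_sbmLaw {n k : ℕ} {α β : ℝ} (hα : α ∈ Set.Icc (0 : ℝ) 1)
    (hβ : β ∈ Set.Icc (0 : ℝ) 1) (c c' : Fin n → Fin k) :
    affinity (sbmLaw α β c) (sbmLaw α β c') =
      ∏ i, ∏ j ∈ Finset.Ioi i, pairAffinity α β c c' i j := by
  classical
  obtain ⟨h1, h2⟩ := hα
  obtain ⟨h3, h4⟩ := hβ
  set f : (Fin n → Fin k) → Fin n → Fin n → Prop → ℝ := fun c i j b =>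
    if b then (if c i = c j then α else β) else 1 - (if c i = c j then α else β) with hf
  have hf0 : ∀ c i j b, 0 ≤ f c i j b := by
    intro c i j b
    simp only [hf]
    split_ifs <;> linarith
  calc affinity (sbmLaw α β c) (sbmLaw α β c')
      = ∑ G : SimpleGraph (Fin n), ∏ i, ∏ j ∈ Finset.Ioi i,
          √(f c i j (G.Adj i j) * f c' i j (G.Adj i j)) := by
        refine Finset.sum_congr rfl fun G _ => ?_
        have : sbmLaw α β c G * sbmLaw α β c' G =
            ∏ i, ∏ j ∈ Finset.Ioi i, f c i j (G.Adj i j) * f c' i j (G.Adj i j) := by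
          simp only [sbmLaw, hf, Finset.prod_mul_distrib]
        rw [this, Real.sqrt_prod _ fun i _ => Finset.prod_nonneg fun j _ =>
          mul_nonneg (hf0 _ _ _ _) (hf0 _ _ _ _)]
        exact Finset.prod_congr rfl fun i _ => Real.sqrt_prod _ fun j _ =>
          mul_nonneg (hf0 _ _ _ _) (hf0 _ _ _ _)
    _ = _ := by
        rw [sum_simpleGraph_prod fun i j b => √(f c i j b * f c' i j b)]
        refine Finset.prod_congr rfl fun i _ => Finset.prod_congr rfl fun j _ => ?_
        simp only [hf, if_true, if_false, pairAffinity]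
        have hαα := edgeAffinity_self ⟨h1, h2⟩
        have hββ := edgeAffinity_self ⟨h3, h4⟩
        have hc := edgeAffinity_comm α β
        by_cases e : c i = c j <;> by_cases e' : c' i = c' j <;>
          simp only [e, e', if_true, if_false, iff_self, iff_true, iff_false, not_true] <;>
          first | exact hαα | exact hββ | rfl | exact hc.symm

theorem entryLaw_mem_stdSimplex {Z : Type*} [Fintype Z] {p : ℝ} (hp : p ∈ Set.Icc (0 : ℝ) 1)
    {q : Z → ℝ} (hq : q ∈ stdSimplex ℝ Z) : entryLaw p q ∈ stdSimplex ℝ (Option Z) := by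
  constructor
  · rintro (_ | v)
    · exact sub_nonneg.2 hp.2
    · exact mul_nonneg hp.1 (hq.1 v)
  · rw [Fintype.sum_option]
    simp [entryLaw, ← Finset.mul_sum, hq.2]

theorem affinity_entryLaw {Z : Type*} [Fintype Z] {p : ℝ} (hp : p ∈ Set.Icc (0 : ℝ) 1)
    (q q' : Z → ℝ) : affinity (entryLaw p q) (entryLaw p q') = 1 - p * hellingerSq q q' := by
  have h : ∀ v, √(p * q v * (p * q' v)) = p * √(q v * q' v) := fun v => by
    rw [show p * q v * (p * q' v) = p ^ 2 * (q v * q' v) by ring,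
      Real.sqrt_mul (sq_nonneg p), Real.sqrt_sq hp.1]
  rw [affinity, Fintype.sum_option]
  simp only [entryLaw, h, hellingerSq]
  rw [Real.sqrt_mul_self (sub_nonneg.2 hp.2), ← Finset.mul_sum]
  ring

/-- Sums of products over all matrices factor. -/
theorem sum_matrix_prod {n m : ℕ} {A : Type*} [Fintype A] (g : Fin n → Fin m → A → ℝ) :
    ∑ U : Fin n → Fin m → A, ∏ i, ∏ j, g i j (U i j) = ∏ i, ∏ j, ∑ a, g i j a := by
  rw [← Fintype.piFinset_univ, ← Finset.prod_univ_sum (fun _ => Finset.univ)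
    fun i (r : Fin m → A) => ∏ j, g i j (r j)]
  refine Finset.prod_congr rfl fun i _ => ?_
  rw [Finset.prod_univ_sum, Fintype.piFinset_univ]

theorem affinity_prod {X Y : Type*} [Fintype X] [Fintype Y] {P P' : X → ℝ} {R R' : Y → ℝ}
    (hP : ∀ x, 0 ≤ P x) (hP' : ∀ x, 0 ≤ P' x) :
    affinity (fun x : X × Y => P x.1 * R x.2) (fun x => P' x.1 * R' x.2) =
      affinity P P' * affinity R R' := by
  simp only [affinity, Finset.sum_mul_sum, Fintype.sum_prod_type]
  refine Finset.sum_congr rfl fun x _ => Finset.sum_congr rfl fun y _ => ?_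
  rw [← Real.sqrt_mul (mul_nonneg (hP x) (hP' x))]
  congr 1
  ring

section ObsLaw

variable {n m k₁ k₂ : ℕ} {Z : Type*} [Fintype Z] {Q : Z → Z → ℝ} {p α₁ β₁ α₂ β₂ : ℝ}

theorem obsLaw_nonneg (hQ : ∀ u, Q u ∈ stdSimplex ℝ Z) (hp : p ∈ Set.Icc (0 : ℝ) 1)
    (hα₁ : α₁ ∈ Set.Icc (0 : ℝ) 1) (hβ₁ : β₁ ∈ Set.Icc (0 : ℝ) 1)
    (hα₂ : α₂ ∈ Set.Icc (0 : ℝ) 1) (hβ₂ : β₂ ∈ Set.Icc (0 : ℝ) 1)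
    (ξ : Triple n m k₁ k₂ Z) (x : Obs n m Z) : 0 ≤ obsLaw Q p α₁ β₁ α₂ β₂ ξ x :=
  mul_nonneg (mul_nonneg (Finset.prod_nonneg fun _ _ => Finset.prod_nonneg fun _ _ =>
    (entryLaw_mem_stdSimplex hp (hQ _)).1 _) (sbmLaw_nonneg hα₁ hβ₁ _ _))
    (sbmLaw_nonneg hα₂ hβ₂ _ _)

theorem affinity_obsLaw (hQ : ∀ u, Q u ∈ stdSimplex ℝ Z) (hp : p ∈ Set.Icc (0 : ℝ) 1)
    (hα₁ : α₁ ∈ Set.Icc (0 : ℝ) 1) (hβ₁ : β₁ ∈ Set.Icc (0 : ℝ) 1)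
    (hα₂ : α₂ ∈ Set.Icc (0 : ℝ) 1) (hβ₂ : β₂ ∈ Set.Icc (0 : ℝ) 1)
    (ξ ξ' : Triple n m k₁ k₂ Z) :
    affinity (obsLaw Q p α₁ β₁ α₂ β₂ ξ) (obsLaw Q p α₁ β₁ α₂ β₂ ξ') =
      (∏ i, ∏ j, (1 - p * hellingerSq (Q (ξ.N i j)) (Q (ξ'.N i j)))) *
        ((∏ i, ∏ i' ∈ Finset.Ioi i, pairAffinity α₁ β₁ ξ.σ ξ'.σ i i') *
          ∏ j, ∏ j' ∈ Finset.Ioi j, pairAffinity α₂ β₂ ξ.τ ξ'.τ j j') := by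
  set ratings : Triple n m k₁ k₂ Z → (Fin n → Fin m → Option Z) → ℝ := fun ξ U =>
    ∏ i, ∏ j, entryLaw p (Q (ξ.N i j)) (U i j) with hr
  set graphs : Triple n m k₁ k₂ Z → SimpleGraph (Fin n) × SimpleGraph (Fin m) → ℝ := fun ξ y =>
    sbmLaw α₁ β₁ ξ.σ y.1 * sbmLaw α₂ β₂ ξ.τ y.2 with hg
  have hl : ∀ ξ : Triple n m k₁ k₂ Z, obsLaw Q p α₁ β₁ α₂ β₂ ξ = fun x =>
      ratings ξ x.1 * graphs ξ x.2 := fun ξ => by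
    funext x
    simp only [obsLaw, hr, hg, mul_assoc]
  have he : ∀ u o, 0 ≤ entryLaw p (Q u) o := fun u => (entryLaw_mem_stdSimplex hp (hQ u)).1
  have hr0 : ∀ ξ U, 0 ≤ ratings ξ U := fun ξ U =>
    Finset.prod_nonneg fun _ _ => Finset.prod_nonneg fun _ _ => he _ _
  have hgr : affinity (graphs ξ) (graphs ξ') = _ :=
    affinity_prod (sbmLaw_nonneg hα₁ hβ₁ _) (sbmLaw_nonneg hα₁ hβ₁ _)
  rw [hl, hl]
  refine (affinity_prod (hr0 ξ) (hr0 ξ')).trans ?_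
  rw [hgr, affinity_sbmLaw hα₁ hβ₁, affinity_sbmLaw hα₂ hβ₂]
  congr 1
  calc affinity (ratings ξ) (ratings ξ')
      = ∑ U : Fin n → Fin m → Option Z, ∏ i, ∏ j,
          √(entryLaw p (Q (ξ.N i j)) (U i j) * entryLaw p (Q (ξ'.N i j)) (U i j)) := by
        refine Finset.sum_congr rfl fun U _ => ?_
        simp only [hr, ← Finset.prod_mul_distrib]
        rw [Real.sqrt_prod _ fun i _ => Finset.prod_nonneg fun j _ =>
          mul_nonneg (he _ _) (he _ _)]
        exact Finset.prod_congr rfl fun i _ => Real.sqrt_prod _ fun j _ =>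
          mul_nonneg (he _ _) (he _ _)
    _ = _ := by
        rw [sum_matrix_prod fun i j o =>
          √(entryLaw p (Q (ξ.N i j)) o * entryLaw p (Q (ξ'.N i j)) o)]
        exact Finset.prod_congr rfl fun i _ => Finset.prod_congr rfl fun j _ =>
          affinity_entryLaw hp _ _

theorem hellingerSq_self {q : Z → ℝ} (hq : q ∈ stdSimplex ℝ Z) : hellingerSq q q = 0 := by
  rw [hellingerSq_eq, affinity_self hq.1, hq.2, sub_self]

theorem sum_obsLaw (hQ : ∀ u, Q u ∈ stdSimplex ℝ Z) (hp : p ∈ Set.Icc (0 : ℝ) 1)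
    (hα₁ : α₁ ∈ Set.Icc (0 : ℝ) 1) (hβ₁ : β₁ ∈ Set.Icc (0 : ℝ) 1)
    (hα₂ : α₂ ∈ Set.Icc (0 : ℝ) 1) (hβ₂ : β₂ ∈ Set.Icc (0 : ℝ) 1)
    (ξ : Triple n m k₁ k₂ Z) : ∑ x, obsLaw Q p α₁ β₁ α₂ β₂ ξ x = 1 := by
  rw [← affinity_self (obsLaw_nonneg hQ hp hα₁ hβ₁ hα₂ hβ₂ ξ),
    affinity_obsLaw hQ hp hα₁ hβ₁ hα₂ hβ₂]
  simp [pairAffinity, hellingerSq_self (hQ _)]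

end ObsLaw

/-! ### Balanced relabellings of two clusters -/

theorem hellingerSq_comm {Z : Type*} [Fintype Z] (P P' : Z → ℝ) :
    hellingerSq P P' = hellingerSq P' P := by
  simp [hellingerSq, mul_comm]

/-- The labelling that agrees with `c` off `S`, and on `S` has label `a` exactly on `T` and label
`a'` elsewhere. -/
def relabel {n k : ℕ} (c : Fin n → Fin k) (a a' : Fin k) (S T : Finset (Fin n)) : Fin n → Fin k :=
  fun x => if x ∈ S then (if x ∈ T then a else a') else c x

/-- The nodes with label `a` or `a'`. -/
def twoClusters {n k : ℕ} (c : Fin n → Fin k) (a a' : Fin k) : Finset (Fin n) :=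
  Finset.univ.filter fun x => c x = a ∨ c x = a'

theorem exists_balanced (k N : ℕ) : ∃ c : Fin (k * N) → Fin k, Balanced c := by
  classical
  refine ⟨fun x => (finProdFinEquiv.symm x).1, fun a => ?_⟩
  congr 1
  have : (Finset.univ.filter fun x : Fin (k * N) => (finProdFinEquiv.symm x).1 = a) =
      (Finset.univ : Finset (Fin N)).map
        ⟨fun j => finProdFinEquiv (a, j), fun j j' h => by simpa using h⟩ := by
    ext x
    rw [Finset.mem_filter, Finset.mem_map]
    constructor
    · rintro ⟨-, rfl⟩
      exact ⟨(finProdFinEquiv.symm x).2, Finset.mem_univ _, finProdFinEquiv.apply_symm_apply x⟩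
    · rintro ⟨j, -, rfl⟩
      exact ⟨Finset.mem_univ _, congrArg Prod.fst (finProdFinEquiv.symm_apply_apply (a, j))⟩
  rw [this, Finset.card_map, Finset.card_univ, Fintype.card_fin]

section Relabel

variable {k N : ℕ} {c : Fin (k * N) → Fin k} {a a' : Fin k}

theorem Balanced.card_eq [DecidableEq (Fin k)] (hc : Balanced c) (hk : 0 < k) (b : Fin k) :
    (Finset.univ.filter fun x => c x = b).card = N := by
  have := Nat.eq_of_mul_eq_mul_left hk (hc b)
  convert this

theorem card_twoClusters (hc : Balanced c) (h : a ≠ a') : (twoClusters c a a').card = 2 * N := by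
  rw [twoClusters, Finset.filter_or, Finset.card_union_of_disjoint, hc.card_eq a.pos,
    hc.card_eq a.pos, two_mul]
  exact Finset.disjoint_filter.2 fun x _ h1 h2 => h (h1.symm.trans h2)

theorem balanced_relabel (hc : Balanced c) (h : a ≠ a') {T : Finset (Fin (k * N))}
    (hT : T ∈ (twoClusters c a a').powersetCard N) :
    Balanced (relabel c a a' (twoClusters c a a') T) := by
  classical
  obtain ⟨hTS, hTN⟩ := Finset.mem_powersetCard.1 hT
  intro b
  congr 1
  by_cases hb : b = a
  · refine Eq.trans ?_ hTN
    congr 1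
    ext x
    have := @hTS x
    simp only [relabel, twoClusters, Finset.mem_filter, Finset.mem_univ, true_and] at this ⊢
    grind
  · by_cases hb' : b = a'
    · have h1 : (twoClusters c a a' \ T).card = N := by
        rw [Finset.card_sdiff_of_subset hTS, card_twoClusters hc h]; omega
      refine Eq.trans ?_ h1
      congr 1
      ext x
      simp only [relabel, twoClusters, Finset.mem_filter, Finset.mem_univ, true_and,
        Finset.mem_sdiff]
      grind
    · refine Eq.trans ?_ (hc.card_eq a.pos b)
      congr 1
      ext x
      simp only [relabel, twoClusters, Finset.mem_filter, Finset.mem_univ, true_and]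
      grind

end Relabel

theorem sum_Ioi_add_swap {n : ℕ} (f : Fin n → Fin n → ℕ) (hf : ∀ x, f x x = 0) :
    ∑ x, ∑ y ∈ Finset.Ioi x, (f x y + f y x) = ∑ x, ∑ y, f x y := by
  simp only [Finset.sum_add_distrib]
  have h : ∑ x, ∑ y ∈ Finset.Ioi x, f y x = ∑ x, ∑ y ∈ Finset.Iio x, f x y := by
    refine Finset.sum_comm' fun x y => ?_
    simp
  rw [h, ← Finset.sum_add_distrib]
  refine Finset.sum_congr rfl fun x _ => ?_
  rw [← Finset.sum_filter_add_sum_filter_not Finset.univ (fun y => x < y)]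
  congr 1
  · exact Finset.sum_congr (by ext; simp) fun _ _ => rfl
  · refine Finset.sum_subset (fun y hy => ?_) fun y hy hy' => ?_
    · simpa using (Finset.mem_Iio.1 hy).le
    · have h1 : y ≤ x := by simpa using hy
      have h2 : x ≤ y := by simpa using hy'
      rw [le_antisymm h1 h2]
      exact hf _

/-- A pair of nodes feels the difference between two relabellings exactly when one of its nodes
lies in the symmetric difference `D` and the other in `S \ D`. -/
theorem prod_pairAffinity_relabel {n k : ℕ} (α β : ℝ) (c : Fin n → Fin k) {a a' : Fin k}
    (h : a ≠ a') {T T' : Finset (Fin n)} (hT : T ⊆ twoClusters c a a')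
    (hT' : T' ⊆ twoClusters c a a') :
    ∏ i, ∏ i' ∈ Finset.Ioi i, pairAffinity α β (relabel c a a' (twoClusters c a a') T)
      (relabel c a a' (twoClusters c a a') T') i i' =
    edgeAffinity α β ^ ((symmDiff T T').card *
      ((twoClusters c a a').card - (symmDiff T T').card)) := by
  set S := twoClusters c a a' with hS
  set D := symmDiff T T' with hD
  have hDS : D ⊆ S := fun x hx => by
    rcases Finset.mem_symmDiff.1 hx with h | h
    · exact hT h.1
    · exact hT' h.1
  set f : Fin n → Fin n → ℕ := fun x y => if x ∈ D ∧ y ∈ S \ D then 1 else 0 with hf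
  have hpair : ∀ x y, pairAffinity α β (relabel c a a' S T) (relabel c a a' S T') x y =
      edgeAffinity α β ^ (f x y + f y x) := by
    intro x y
    have hx1 := @hT x
    have hx2 := @hT' x
    have hy1 := @hT y
    have hy2 := @hT' y
    have hx3 : x ∈ S ↔ c x = a ∨ c x = a' := by simp [hS, twoClusters]
    have hy3 : y ∈ S ↔ c y = a ∨ c y = a' := by simp [hS, twoClusters]
    have hxD : x ∈ D ↔ (x ∈ T ∧ x ∉ T' ∨ x ∈ T' ∧ x ∉ T) := Finset.mem_symmDiff
    have hyD : y ∈ D ↔ (y ∈ T ∧ y ∉ T' ∨ y ∈ T' ∧ y ∉ T) := Finset.mem_symmDiff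
    have key : (relabel c a a' S T x = relabel c a a' S T y ↔
        relabel c a a' S T' x = relabel c a a' S T' y) ↔
        ¬ (x ∈ D ∧ y ∈ S \ D) ∧ ¬ (y ∈ D ∧ x ∈ S \ D) := by
      simp only [relabel, Finset.mem_sdiff]
      by_cases x ∈ S <;> by_cases y ∈ S <;> grind
    rw [pairAffinity]
    by_cases h1 : x ∈ D ∧ y ∈ S \ D
    · have h2 : ¬ (y ∈ D ∧ x ∈ S \ D) := fun h2 => (Finset.mem_sdiff.1 h1.2).2 h2.1
      rw [if_neg (fun hh => (key.1 hh).1 h1)]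
      simp only [hf, if_pos h1, if_neg h2]
      simp
    · by_cases h2 : y ∈ D ∧ x ∈ S \ D
      · rw [if_neg (fun hh => (key.1 hh).2 h2)]
        simp only [hf, if_neg h1, if_pos h2]
        simp
      · rw [if_pos (key.2 ⟨h1, h2⟩)]
        simp only [hf, if_neg h1, if_neg h2]
        simp
  simp only [hpair, Finset.prod_pow_eq_pow_sum]
  congr 1
  rw [sum_Ioi_add_swap]
  · have h1 : ∀ x y, f x y = (if x ∈ D then 1 else 0) * (if y ∈ S \ D then 1 else 0) :=
      fun x y => by simp only [hf, ite_and]; split_ifs <;> rfl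
    simp only [h1, ← Finset.mul_sum, ← Finset.sum_mul]
    simp only [← Finset.card_filter, Finset.filter_mem_eq_inter, Finset.univ_inter]
    rw [Finset.card_sdiff_of_subset hDS]
  · intro x
    refine if_neg ?_
    simp +contextual

theorem prod_pairAffinity_self {n k : ℕ} (α β : ℝ) (c : Fin n → Fin k) :
    ∏ i, ∏ i' ∈ Finset.Ioi i, pairAffinity α β c c i i' = 1 := by
  simp [pairAffinity]

theorem relabel_eq_or {n k : ℕ} (c : Fin n → Fin k) (a a' : Fin k) (S : Finset (Fin n))
    {T T' : Finset (Fin n)} (hT : T ⊆ S) (hT' : T' ⊆ S) (x : Fin n) :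
    (x ∈ symmDiff T T' → relabel c a a' S T x = a ∧ relabel c a a' S T' x = a' ∨
      relabel c a a' S T x = a' ∧ relabel c a a' S T' x = a) ∧
    (x ∉ symmDiff T T' → relabel c a a' S T x = relabel c a a' S T' x) := by
  have h1 := @hT x
  have h2 := @hT' x
  simp only [Finset.mem_symmDiff, relabel]
  grind

/-- The rows in which two relabellings differ contribute equal factors, the other rows `1`. The
profile `q a x` is the law of the entry `x` of a row with label `a`. -/
theorem prod_rows_relabel {n k : ℕ} {Z : Type*} [Fintype Z] {A : Type*} [Fintype A] (p : ℝ)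
    (q : Fin k → A → Z → ℝ) (hq : ∀ b x, q b x ∈ stdSimplex ℝ Z) (c : Fin n → Fin k)
    (a a' : Fin k) (S : Finset (Fin n)) {T T' : Finset (Fin n)} (hT : T ⊆ S) (hT' : T' ⊆ S) :
    ∏ i, ∏ x, (1 - p * hellingerSq (q (relabel c a a' S T i) x) (q (relabel c a a' S T' i) x)) =
      (∏ x, (1 - p * hellingerSq (q a x) (q a' x))) ^ (symmDiff T T').card := by
  rw [← Finset.prod_const, ← Finset.prod_subset (Finset.subset_univ (symmDiff T T'))]
  · refine Finset.prod_congr rfl fun i hi => Finset.prod_congr rfl fun x _ => ?_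
    rcases (relabel_eq_or c a a' S hT hT' i).1 hi with ⟨h1, h2⟩ | ⟨h1, h2⟩
    · rw [h1, h2]
    · rw [h1, h2, hellingerSq_comm]
  · intro i _ hi
    refine Finset.prod_eq_one fun x _ => ?_
    rw [(relabel_eq_or c a a' S hT hT' i).2 hi, hellingerSq_self (hq _ _)]
    ring

/-- Two relabellings that give each row the same law coincide. -/
theorem eq_of_profile_relabel {n k : ℕ} {W : Type*} (q : Fin k → W) (c : Fin n → Fin k)
    {a a' : Fin k} (hq : q a ≠ q a') (S : Finset (Fin n)) {T T' : Finset (Fin n)} (hT : T ⊆ S)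
    (hT' : T' ⊆ S) (h : ∀ i, q (relabel c a a' S T i) = q (relabel c a a' S T' i)) : T = T' := by
  by_contra hne
  obtain ⟨i, hi⟩ : (symmDiff T T').Nonempty := by
    rw [Finset.nonempty_iff_ne_empty]
    exact fun he => hne (symmDiff_eq_bot.1 he)
  have h' := h i
  rcases (relabel_eq_or c a a' S hT hT' i).1 hi with ⟨h1, h2⟩ | ⟨h1, h2⟩
  · rw [h1, h2] at h'
    exact hq h'
  · rw [h1, h2] at h'
    exact hq h'.symm

/-! ### From average success to maximal error -/

section MaxError

variable {n m k₁ k₂ : ℕ} {Z : Type*} [Fintype Z] {Q : Z → Z → ℝ} {p α₁ β₁ α₂ β₂ : ℝ}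

theorem errorProb_le_one (hQ : ∀ u, Q u ∈ stdSimplex ℝ Z) (hp : p ∈ Set.Icc (0 : ℝ) 1)
    (hα₁ : α₁ ∈ Set.Icc (0 : ℝ) 1) (hβ₁ : β₁ ∈ Set.Icc (0 : ℝ) 1)
    (hα₂ : α₂ ∈ Set.Icc (0 : ℝ) 1) (hβ₂ : β₂ ∈ Set.Icc (0 : ℝ) 1)
    (φ : Estimator n m k₁ k₂ Z) (ξ : Triple n m k₁ k₂ Z) :
    errorProb Q p α₁ β₁ α₂ β₂ φ ξ ≤ 1 := by
  rw [← sum_obsLaw hQ hp hα₁ hβ₁ hα₂ hβ₂ ξ]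
  refine Finset.sum_le_sum fun x _ => ?_
  split_ifs
  · exact le_rfl
  · exact obsLaw_nonneg hQ hp hα₁ hβ₁ hα₂ hβ₂ ξ x

theorem maxErrorProb_le_one (hQ : ∀ u, Q u ∈ stdSimplex ℝ Z) (hp : p ∈ Set.Icc (0 : ℝ) 1)
    (hα₁ : α₁ ∈ Set.Icc (0 : ℝ) 1) (hβ₁ : β₁ ∈ Set.Icc (0 : ℝ) 1)
    (hα₂ : α₂ ∈ Set.Icc (0 : ℝ) 1) (hβ₂ : β₂ ∈ Set.Icc (0 : ℝ) 1)
    (φ : Estimator n m k₁ k₂ Z) (Θ : Set (Triple n m k₁ k₂ Z)) :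
    maxErrorProb Θ Q p α₁ β₁ α₂ β₂ φ ≤ 1 :=
  Real.iSup_le (fun ξ => errorProb_le_one hQ hp hα₁ hβ₁ hα₂ hβ₂ φ ξ) zero_le_one

open Classical in
/-- An estimator that misses the nominal matrix errs, whatever its labels. -/
theorem one_sub_le_errorProb (hQ : ∀ u, Q u ∈ stdSimplex ℝ Z) (hp : p ∈ Set.Icc (0 : ℝ) 1)
    (hα₁ : α₁ ∈ Set.Icc (0 : ℝ) 1) (hβ₁ : β₁ ∈ Set.Icc (0 : ℝ) 1)
    (hα₂ : α₂ ∈ Set.Icc (0 : ℝ) 1) (hβ₂ : β₂ ∈ Set.Icc (0 : ℝ) 1)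
    (φ : Estimator n m k₁ k₂ Z) (ξ : Triple n m k₁ k₂ Z) :
    1 - ∑ x, (if (φ x).N = ξ.N then obsLaw Q p α₁ β₁ α₂ β₂ ξ x else 0) ≤
      errorProb Q p α₁ β₁ α₂ β₂ φ ξ := by
  rw [sub_le_iff_le_add, ← sum_obsLaw hQ hp hα₁ hβ₁ hα₂ hβ₂ ξ, errorProb,
    ← Finset.sum_add_distrib]
  refine Finset.sum_le_sum fun x _ => ?_
  have h0 := obsLaw_nonneg hQ hp hα₁ hβ₁ hα₂ hβ₂ ξ x
  by_cases h : (φ x).N = ξ.N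
  · rw [if_pos h]
    split_ifs <;> linarith
  · have he : IsError ξ (φ x) := Or.inr (Or.inr h)
    rw [if_neg h, if_pos he]
    linarith

/-- Affinity of two laws that differ in `t` of the `2N` nodes of two clusters, when a differing
node contributes the factor `R` through its ratings and `ρ` through each affected pair. -/
noncomputable def pairedAffinity (N : ℕ) (R ρ : ℝ) (t : ℕ) : ℝ := R ^ t * ρ ^ (t * (2 * N - t))

/-- Upper bound on the average success probability over a family of `N`-subsets, where `G` is `N`
times the affinity of one exchange and `ρ` the affinity of one edge. -/
noncomputable def successBound (G ρ : ℝ) : ℝ := 4 / G ^ 2 + 4 / G + 2 * ((ρ ^ 8)⁻¹ - 1)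

theorem pairedAffinity_four_div {N : ℕ} (hN : 2 ≤ N) {R ρ : ℝ} (hR : 0 < R) (hρ : 0 < ρ) :
    pairedAffinity N R ρ 4 / pairedAffinity N R ρ 2 ^ 2 = (ρ ^ 8)⁻¹ := by
  have h : 2 * (2 * (2 * N - 2)) = 4 * (2 * N - 4) + 8 := by omega
  have : pairedAffinity N R ρ 2 ^ 2 = pairedAffinity N R ρ 4 * ρ ^ 8 := by
    rw [pairedAffinity, pairedAffinity, mul_pow, mul_assoc, ← pow_add, ← h]
    ring
  have h4 : 0 < pairedAffinity N R ρ 4 := by unfold pairedAffinity; positivity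
  rw [this]
  field_simp

/-- Lower bound on the maximal error over `Θ` through a family in `Θ` indexed by the `N`-subsets of
a `2N`-set, whose members have distinct nominal matrices. -/
theorem one_sub_le_maxErrorProb {ι : Type*} [DecidableEq ι]
    (hQ : ∀ u, Q u ∈ stdSimplex ℝ Z) (hp : p ∈ Set.Icc (0 : ℝ) 1)
    (hα₁ : α₁ ∈ Set.Icc (0 : ℝ) 1) (hβ₁ : β₁ ∈ Set.Icc (0 : ℝ) 1)
    (hα₂ : α₂ ∈ Set.Icc (0 : ℝ) 1) (hβ₂ : β₂ ∈ Set.Icc (0 : ℝ) 1)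
    (φ : Estimator n m k₁ k₂ Z) (Θ : Set (Triple n m k₁ k₂ Z)) {S : Finset ι} {N : ℕ}
    (hN : 2 ≤ N) (hS : S.card = 2 * N) (ξ : Finset ι → Triple n m k₁ k₂ Z)
    (hξ : ∀ T ∈ S.powersetCard N, ξ T ∈ Θ)
    (hinj : Set.InjOn (fun T => (ξ T).N) (S.powersetCard N : Finset (Finset ι)))
    {R ρ : ℝ} (hR : 0 < R) (hρ : 0 < ρ)
    (haff : ∀ T ∈ S.powersetCard N, ∀ T' ∈ S.powersetCard N,
      affinity (obsLaw Q p α₁ β₁ α₂ β₂ (ξ T)) (obsLaw Q p α₁ β₁ α₂ β₂ (ξ T')) =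
        pairedAffinity N R ρ (symmDiff T T').card) :
    1 - successBound (N * pairedAffinity N R ρ 2) ρ ≤ maxErrorProb Θ Q p α₁ β₁ α₂ β₂ φ := by
  classical
  have hF : ∀ t, 0 < pairedAffinity N R ρ t := fun t => by unfold pairedAffinity; positivity
  have key := sum_success_le (by omega) hS (fun T => obsLaw Q p α₁ β₁ α₂ β₂ (ξ T))
    (fun T => obsLaw_nonneg hQ hp hα₁ hβ₁ hα₂ hβ₂ (ξ T))
    (fun T => sum_obsLaw hQ hp hα₁ hβ₁ hα₂ hβ₂ (ξ T)) (pairedAffinity N R ρ)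
    (fun t => (hF t).le) (by simp [pairedAffinity]) (hF 2) haff (fun T => (ξ T).N) hinj
    (fun x => (φ x).N)
  rw [pairedAffinity_four_div hN hR hρ, ← successBound] at key
  set B := successBound (N * pairedAffinity N R ρ 2) ρ
  have hcard : (0 : ℝ) < (S.powersetCard N).card := by
    rw [Finset.card_powersetCard, hS]
    exact_mod_cast Nat.choose_pos (by omega)
  have hmax : ∀ T ∈ S.powersetCard N,
      1 - ∑ x, (if (φ x).N = (ξ T).N then obsLaw Q p α₁ β₁ α₂ β₂ (ξ T) x else 0) ≤
        maxErrorProb Θ Q p α₁ β₁ α₂ β₂ φ := fun T hT =>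
    (one_sub_le_errorProb hQ hp hα₁ hβ₁ hα₂ hβ₂ φ (ξ T)).trans
      (le_ciSup (f := fun ξ : Θ => errorProb Q p α₁ β₁ α₂ β₂ φ ξ)
        ⟨1, by rintro _ ⟨ξ, rfl⟩; exact errorProb_le_one hQ hp hα₁ hβ₁ hα₂ hβ₂ φ ξ⟩
        ⟨ξ T, hξ T hT⟩)
  have hsum := Finset.sum_le_sum hmax
  rw [Finset.sum_sub_distrib, Finset.sum_const, Finset.sum_const, nsmul_eq_mul, nsmul_eq_mul,
    mul_one] at hsum
  refine le_of_mul_le_mul_left ?_ hcard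
  calc _ = ((S.powersetCard N).card : ℝ) - (S.powersetCard N).card * B := by ring
    _ ≤ _ := by linarith

end MaxError

/-! ### The two families of hypotheses -/

section Families

variable {k₁ k₂ N M : ℕ} {Z : Type*} [Fintype Z] {Q : Z → Z → ℝ} {p α₁ β₁ α₂ β₂ : ℝ}
  {z : Fin k₁ → Fin k₂ → Z}

theorem exists_minUserDisc (hk₁ : 2 ≤ k₁) (Q : Z → Z → ℝ) (z : Fin k₁ → Fin k₂ → Z) :
    ∃ a a', a ≠ a' ∧ ∑ b, hellingerSq (Q (z a b)) (Q (z a' b)) = minUserDisc Q z := by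
  have : Nonempty {a : Fin k₁ × Fin k₁ // a.1 ≠ a.2} :=
    ⟨⟨(⟨0, by omega⟩, ⟨1, by omega⟩), by simp⟩⟩
  obtain ⟨⟨⟨a, a'⟩, h⟩, he⟩ := exists_eq_ciInf_of_finite
    (f := fun a : {a : Fin k₁ × Fin k₁ // a.1 ≠ a.2} =>
      ∑ b : Fin k₂, hellingerSq (Q (z a.1.1 b)) (Q (z a.1.2 b)))
  exact ⟨a, a', h, he⟩

theorem minItemDisc_eq (Q : Z → Z → ℝ) (z : Fin k₁ → Fin k₂ → Z) :
    minItemDisc Q z = minUserDisc Q fun b a => z a b := rfl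

theorem prod_comp_balanced (hk : 0 < k₂) {τ : Fin (k₂ * M) → Fin k₂} (hτ : Balanced τ)
    (f : Fin k₂ → ℝ) : ∏ j, f (τ j) = ∏ b, f b ^ M := by
  classical
  rw [← Finset.prod_fiberwise Finset.univ τ]
  refine Finset.prod_congr rfl fun b _ => ?_
  rw [Finset.prod_congr rfl fun j hj => by rw [(Finset.mem_filter.1 hj).2], Finset.prod_const,
    hτ.card_eq hk]

/-- Affinity of the laws of a line of the rating matrix (the row of a user, the column of an item)
under two profiles of nominal ratings `q` and `q'`, with `M` entries from each cluster of the other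
side. -/
noncomputable def ratingAffinity (Q : Z → Z → ℝ) (p : ℝ) (M : ℕ) {k : ℕ} (q q' : Fin k → Z) : ℝ :=
  ∏ b, (1 - p * hellingerSq (Q (q b)) (Q (q' b))) ^ M

theorem Balanced.surjective {k N : ℕ} {c : Fin (k * N) → Fin k} (hN : 0 < N) (hc : Balanced c) :
    Function.Surjective c := by
  classical
  intro b
  have : 0 < (Finset.univ.filter fun x => c x = b).card := by rw [hc.card_eq b.pos]; exact hN
  obtain ⟨x, hx⟩ := Finset.card_pos.1 this
  exact ⟨x, (Finset.mem_filter.1 hx).2⟩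

/-- Converse from the hypotheses that reassign two user clusters. -/
theorem one_sub_le_maxErrorProb_user
    (hQ : ∀ u, Q u ∈ stdSimplex ℝ Z) (hp : p ∈ Set.Icc (0 : ℝ) 1)
    (hα₁ : α₁ ∈ Set.Icc (0 : ℝ) 1) (hβ₁ : β₁ ∈ Set.Icc (0 : ℝ) 1)
    (hα₂ : α₂ ∈ Set.Icc (0 : ℝ) 1) (hβ₂ : β₂ ∈ Set.Icc (0 : ℝ) 1)
    (φ : Estimator (k₁ * N) (k₂ * M) k₁ k₂ Z) {Θ : Set (Triple (k₁ * N) (k₂ * M) k₁ k₂ Z)}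
    (hΘ : paramSpaceOf (k₁ * N) (k₂ * M) z ⊆ Θ) (hN : 2 ≤ N) (hM : 0 < M)
    (hk₂ : 0 < k₂) {a a' : Fin k₁} (ha : a ≠ a') (hz : z a ≠ z a')
    (hR : 0 < ratingAffinity Q p M (z a) (z a')) (hρ : 0 < edgeAffinity α₁ β₁) :
    1 - successBound
      (N * pairedAffinity N (ratingAffinity Q p M (z a) (z a')) (edgeAffinity α₁ β₁) 2)
      (edgeAffinity α₁ β₁) ≤ maxErrorProb Θ Q p α₁ β₁ α₂ β₂ φ := by
  obtain ⟨σ, hσ⟩ := exists_balanced k₁ N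
  obtain ⟨τ, hτ⟩ := exists_balanced k₂ M
  set S := twoClusters σ a a' with hS
  have hScard : S.card = 2 * N := card_twoClusters hσ ha
  refine one_sub_le_maxErrorProb hQ hp hα₁ hβ₁ hα₂ hβ₂ φ Θ hN hScard
    (fun T => ⟨relabel σ a a' S T, τ, fun i j => z (relabel σ a a' S T i) (τ j)⟩)
    (fun T hT => hΘ ⟨⟨balanced_relabel hσ ha hT, hτ, fun i i' j j' h h' => ?_⟩, fun _ _ => rfl⟩)
    (fun T hT T' hT' h => ?_) hR hρ (fun T hT T' hT' => ?_)
  · dsimp only at h h' ⊢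
    rw [h, h']
  · refine eq_of_profile_relabel z σ hz S (Finset.mem_powersetCard.1 hT).1
      (Finset.mem_powersetCard.1 hT').1 fun i => funext fun b => ?_
    obtain ⟨j, rfl⟩ := hτ.surjective hM b
    exact congrFun (congrFun h i) j
  · have h1 := (Finset.mem_powersetCard.1 hT).1
    have h2 := (Finset.mem_powersetCard.1 hT').1
    rw [affinity_obsLaw hQ hp hα₁ hβ₁ hα₂ hβ₂]
    dsimp only
    rw [prod_pairAffinity_self, mul_one, prod_pairAffinity_relabel α₁ β₁ σ ha h1 h2, ← hS, hScard,
      prod_rows_relabel p (fun b j => Q (z b (τ j))) (fun _ _ => hQ _) σ a a' S h1 h2,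
      prod_comp_balanced hk₂ hτ fun b => 1 - p * hellingerSq (Q (z a b)) (Q (z a' b))]
    rfl

/-- Converse from the hypotheses that reassign two item clusters. -/
theorem one_sub_le_maxErrorProb_item
    (hQ : ∀ u, Q u ∈ stdSimplex ℝ Z) (hp : p ∈ Set.Icc (0 : ℝ) 1)
    (hα₁ : α₁ ∈ Set.Icc (0 : ℝ) 1) (hβ₁ : β₁ ∈ Set.Icc (0 : ℝ) 1)
    (hα₂ : α₂ ∈ Set.Icc (0 : ℝ) 1) (hβ₂ : β₂ ∈ Set.Icc (0 : ℝ) 1)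
    (φ : Estimator (k₁ * N) (k₂ * M) k₁ k₂ Z) {Θ : Set (Triple (k₁ * N) (k₂ * M) k₁ k₂ Z)}
    (hΘ : paramSpaceOf (k₁ * N) (k₂ * M) z ⊆ Θ) (hN : 0 < N) (hM : 2 ≤ M)
    (hk₁ : 0 < k₁) {b b' : Fin k₂} (hb : b ≠ b') (hz : (fun a => z a b) ≠ fun a => z a b')
    (hR : 0 < ratingAffinity Q p N (fun a => z a b) fun a => z a b')
    (hρ : 0 < edgeAffinity α₂ β₂) :
    1 - successBound
      (M * pairedAffinity M (ratingAffinity Q p N (fun a => z a b) fun a => z a b')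
        (edgeAffinity α₂ β₂) 2)
      (edgeAffinity α₂ β₂) ≤ maxErrorProb Θ Q p α₁ β₁ α₂ β₂ φ := by
  obtain ⟨σ, hσ⟩ := exists_balanced k₁ N
  obtain ⟨τ, hτ⟩ := exists_balanced k₂ M
  set S := twoClusters τ b b' with hS
  have hScard : S.card = 2 * M := card_twoClusters hτ hb
  refine one_sub_le_maxErrorProb hQ hp hα₁ hβ₁ hα₂ hβ₂ φ Θ hM hScard
    (fun T => ⟨σ, relabel τ b b' S T, fun i j => z (σ i) (relabel τ b b' S T j)⟩)
    (fun T hT => hΘ ⟨⟨hσ, balanced_relabel hτ hb hT, fun i i' j j' h h' => ?_⟩, fun _ _ => rfl⟩)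
    (fun T hT T' hT' h => ?_) hR hρ (fun T hT T' hT' => ?_)
  · dsimp only at h h' ⊢
    rw [h, h']
  · refine eq_of_profile_relabel (fun b a => z a b) τ hz S (Finset.mem_powersetCard.1 hT).1
      (Finset.mem_powersetCard.1 hT').1 fun j => funext fun a => ?_
    obtain ⟨i, rfl⟩ := hσ.surjective hN a
    exact congrFun (congrFun h i) j
  · have h1 := (Finset.mem_powersetCard.1 hT).1
    have h2 := (Finset.mem_powersetCard.1 hT').1
    rw [affinity_obsLaw hQ hp hα₁ hβ₁ hα₂ hβ₂]
    dsimp only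
    rw [prod_pairAffinity_self, one_mul, prod_pairAffinity_relabel α₂ β₂ τ hb h1 h2, ← hS, hScard,
      Finset.prod_comm,
      prod_rows_relabel p (fun b i => Q (z (σ i) b)) (fun _ _ => hQ _) τ b b' S h1 h2,
      prod_comp_balanced hk₁ hσ fun a => 1 - p * hellingerSq (Q (z a b)) (Q (z a b'))]
    rfl

end Families

/-! ### Exponents -/

theorem exp_neg_le_one_sub {δ x : ℝ} (hδ : 0 < δ) (hx : 0 ≤ x) (hx' : x ≤ δ / (1 + δ)) :
    Real.exp (-((1 + δ) * x)) ≤ 1 - x := by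
  have h1 : (1 + δ) * x + 1 ≤ Real.exp ((1 + δ) * x) := Real.add_one_le_exp _
  have h2 : (1 + δ) * x ≤ δ := by
    rw [le_div_iff₀ (by positivity)] at hx'
    linarith
  have h3 : 0 < (1 + δ) * x + 1 := by positivity
  rw [Real.exp_neg]
  refine (inv_anti₀ h3 h1).trans ?_
  rw [inv_le_iff_one_le_mul₀ h3]
  nlinarith [mul_nonneg hx (sub_nonneg.2 h2)]

/-- For sparse graphs an edge costs the exponent `(√α - √β)² / 2`, up to a factor close to `1`. -/
theorem exp_le_edgeAffinity {δ α β : ℝ} (hδ : 0 < δ) (hα : 0 ≤ α) (hβ : 0 ≤ β)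
    (hα' : α ≤ δ / (8 * (1 + δ) ^ 2)) (hβ' : β ≤ δ / (8 * (1 + δ) ^ 2)) :
    Real.exp (-((1 + δ) * ((√α - √β) ^ 2 / 2))) ≤ edgeAffinity α β := by
  set x := √α with hx
  set y := √β with hy
  set κ := δ / (8 * (1 + δ) ^ 2) with hκ
  have hxα : x ^ 2 = α := Real.sq_sqrt hα
  have hyβ : y ^ 2 = β := Real.sq_sqrt hβ
  have hx0 : 0 ≤ x := Real.sqrt_nonneg _
  have hy0 : 0 ≤ y := Real.sqrt_nonneg _
  set w := (x - y) ^ 2 / 2 with hw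
  have hw0 : 0 ≤ w := by positivity
  have hκe : κ * (8 * (1 + δ) ^ 2) = δ := div_mul_cancel₀ _ (by positivity)
  have hκ0 : 0 < κ := by positivity
  have hwκ : w ≤ κ := by nlinarith [mul_nonneg hx0 hy0]
  have hκδ : 8 * κ ≤ δ := by nlinarith [mul_pos hκ0 hδ, mul_pos (mul_pos hκ0 hδ) hδ]
  have hκδ' : 16 * (κ * δ) ≤ δ := by nlinarith [mul_pos hκ0 hδ, mul_pos (mul_pos hκ0 hδ) hδ]
  have hκ1 : 16 * κ ≤ 1 := by
    have : 16 * (κ * δ) ≤ δ * 1 := by linarith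
    exact le_of_mul_le_mul_left (by linarith : δ * (16 * κ) ≤ δ * 1) hδ
  have hκ2 : κ * δ ≤ 1 := by
    nlinarith [mul_pos hκ0 hδ, mul_pos (mul_pos hκ0 hδ) hδ, sq_nonneg (1 - δ)]
  have h1 : √(α * β) = x * y := Real.sqrt_mul hα β
  have h2 : 1 - (α + β) / 2 - δ / 2 * w ≤ √((1 - α) * (1 - β)) := by
    refine Real.le_sqrt_of_sq_le ?_
    have e1 : (1 - α) * (1 - β) - (1 - (α + β) / 2 - δ / 2 * w) ^ 2 =
        w * (δ / 2 * (2 - (α + β) - δ / 2 * w) - (x + y) ^ 2 / 2) := by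
      rw [hw, ← hxα, ← hyβ]
      ring
    have e2 : (x + y) ^ 2 ≤ 4 * κ := by nlinarith [sq_nonneg (x - y)]
    have e3 : δ / 2 * w ≤ δ / 2 * κ := by gcongr
    have e4 : 1 ≤ 2 - (α + β) - δ / 2 * w := by linarith
    have e5 : 2 * κ ≤ δ / 2 * (2 - (α + β) - δ / 2 * w) := by nlinarith
    have : 0 ≤ w * (δ / 2 * (2 - (α + β) - δ / 2 * w) - (x + y) ^ 2 / 2) :=
      mul_nonneg hw0 (by linarith)
    linarith
  have h3 : 1 - (1 + δ / 2) * w ≤ edgeAffinity α β := by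
    rw [edgeAffinity, h1]
    have : x * y = (α + β) / 2 - w := by rw [hw, ← hxα, ← hyβ]; ring
    linarith
  refine le_trans ?_ h3
  have h4 : (1 + δ) * w + 1 ≤ Real.exp ((1 + δ) * w) := Real.add_one_le_exp _
  have h5 : 0 < (1 + δ) * w + 1 := by positivity
  rw [Real.exp_neg]
  refine (inv_anti₀ h5 h4).trans ?_
  rw [inv_le_iff_one_le_mul₀ h5]
  have h6 : (1 + δ) ^ 2 * w ≤ δ / 8 := by nlinarith [sq_nonneg (1 + δ)]
  have h7 : (1 + δ / 2) * (1 + δ) * w ≤ δ / 2 := by nlinarith [mul_nonneg hw0 hδ.le]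
  nlinarith [mul_nonneg hw0 (sub_nonneg.2 h7)]

theorem exp_le_prod_pow {l : ℕ} {δ p : ℝ} (hδ : 0 < δ) (hp : 0 ≤ p) (hp' : p ≤ δ / (1 + δ)) (M : ℕ)
    {h : Fin l → ℝ} (h0 : ∀ b, 0 ≤ h b) (h1 : ∀ b, h b ≤ 1) :
    Real.exp (-((1 + δ) * (p * M * ∑ b, h b))) ≤ ∏ b, (1 - p * h b) ^ M := by
  have : Real.exp (-((1 + δ) * (p * M * ∑ b, h b))) =
      ∏ b, Real.exp (-((1 + δ) * (p * h b))) ^ M := by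
    simp only [← Real.exp_nat_mul, ← Real.exp_sum]
    congr 1
    rw [Finset.mul_sum, Finset.mul_sum, ← Finset.sum_neg_distrib]
    exact Finset.sum_congr rfl fun b _ => by ring
  rw [this]
  refine Finset.prod_le_prod (fun b _ => by positivity) fun b _ => ?_
  refine pow_le_pow_left₀ (by positivity) (exp_neg_le_one_sub hδ (mul_nonneg hp (h0 b)) ?_) M
  exact (mul_le_of_le_one_right hp (h1 b)).trans hp'

theorem exp_le_pairedAffinity {N : ℕ} {R ρ δ r s : ℝ} (hδ : 0 < δ) (hs : 0 ≤ s)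
    (hR : Real.exp (-((1 + δ) * r)) ≤ R) (hρ : Real.exp (-((1 + δ) * (s / 2))) ≤ ρ) :
    Real.exp (-((1 + δ) * (2 * r + 2 * N * s))) ≤ pairedAffinity N R ρ 2 := by
  have h1 : ((2 * (2 * N - 2) : ℕ) : ℝ) ≤ 4 * N := by
    have : 2 * (2 * N - 2) ≤ 4 * N := by omega
    exact_mod_cast this
  calc Real.exp (-((1 + δ) * (2 * r + 2 * N * s)))
      ≤ Real.exp (-((1 + δ) * r)) ^ 2 * Real.exp (-((1 + δ) * (s / 2))) ^ (2 * (2 * N - 2)) := by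
        rw [← Real.exp_nat_mul, ← Real.exp_nat_mul, ← Real.exp_add, Real.exp_le_exp]
        have h2 : 0 ≤ (1 + δ) * (s / 2) := by positivity
        have h3 := mul_le_mul_of_nonneg_right h1 h2
        rw [mul_neg, mul_neg]
        push_cast at h3 ⊢
        linarith
    _ ≤ pairedAffinity N R ρ 2 := by
        unfold pairedAffinity
        gcongr

/-- The sample size condition in the form in which it bounds the exponent of an exchange. -/
theorem exponent_le_of_sample {k l n m N M : ℕ} (hk : 0 < k) (hl : 0 < l) (hn : n = k * N)
    (hm : m = l * M) {p α β ε d : ℝ} (hd : 0 < d) (hlog : 0 < Real.log n)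
    (h : (m : ℝ) * n * p <
      ((1 - ε) / 2 - graphQuality n α β / k) * n * Real.log n / (d / l)) :
    2 * (p * M * d) + 2 * N * (√α - √β) ^ 2 < (1 - ε) * Real.log n := by
  have hk' : (0 : ℝ) < k := by exact_mod_cast hk
  have hl' : (0 : ℝ) < l := by exact_mod_cast hl
  have hn0 : (0 : ℝ) < n := by
    rcases Nat.eq_zero_or_pos n with h0 | h0
    · simp [h0] at hlog
    · exact_mod_cast h0
  have hnN : (n : ℝ) = k * N := by exact_mod_cast hn
  have hmM : (m : ℝ) = l * M := by exact_mod_cast hm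
  rw [lt_div_iff₀ (by positivity)] at h
  have e1 : (m : ℝ) * n * p * (d / l) = n * (p * M * d) := by
    rw [hmM]; field_simp
  have e2 : ((1 - ε) / 2 - graphQuality n α β / k) * n * Real.log n =
      n * ((1 - ε) / 2 * Real.log n - N * (√α - √β) ^ 2) := by
    have : graphQuality n α β / k * Real.log n = N * (√α - √β) ^ 2 := by
      rw [graphQuality]
      field_simp
      rw [hnN]
      ring
    linear_combination (-(n : ℝ)) * this
  rw [e1, e2] at h
  have := lt_of_mul_lt_mul_left h hn0.le
  linarith

/-- Along a sequence of models below the threshold for one side, an exchange has affinity at least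
`n ^ (-(1 - ε / 2))`. -/
theorem eventually_le_mul_pairedAffinity {k l : ℕ} (hk : 0 < k) (hl : 0 < l) {h : Fin l → ℝ}
    (h0 : ∀ b, 0 ≤ h b) (h1 : ∀ b, h b ≤ 1) (hd : 0 < ∑ b, h b) {n m N M : ℕ → ℕ}
    (hnN : ∀ t, n t = k * N t) (hmM : ∀ t, m t = l * M t) (hn : Tendsto n atTop atTop)
    (hmn : (fun t => Real.log (n t)) =o[atTop] fun t => (m t : ℝ)) {p α β : ℕ → ℝ}
    (hp : ∀ t, 0 ≤ p t) (hα : ∀ t, 0 ≤ α t) (hβ : ∀ t, 0 ≤ β t)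
    (hα0 : Tendsto α atTop (𝓝 0)) (hβ0 : Tendsto β atTop (𝓝 0)) {ε : ℝ} (hε : 0 < ε) :
    ∀ᶠ t in atTop, (m t : ℝ) * n t * p t <
        ((1 - ε) / 2 - graphQuality (n t) (α t) (β t) / k) * n t * Real.log (n t) /
          ((∑ b, h b) / l) →
      0 < ∏ b, (1 - p t * h b) ^ M t ∧
      Real.exp (ε / 2 * Real.log (n t)) / k ≤
        N t * pairedAffinity (N t) (∏ b, (1 - p t * h b) ^ M t) (edgeAffinity (α t) (β t)) 2 := by
  set d := ∑ b, h b with hdd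
  -- this loss is affordable, since `(1 + ε / 2) * (1 - ε) ≤ 1 - ε / 2`
  set δ := ε / 2 with hδ
  have hδ0 : 0 < δ := by positivity
  have hk' : (0 : ℝ) < k := by exact_mod_cast hk
  have hl' : (0 : ℝ) < l := by exact_mod_cast hl
  have hκ : 0 < δ / (8 * (1 + δ) ^ 2) := by positivity
  have hη : 0 < δ / (1 + δ) * (2 * d / l) := by positivity
  filter_upwards [hα0.eventually_le_const hκ, hβ0.eventually_le_const hκ, hmn.bound hη,
    hn.eventually_ge_atTop 2] with t hαt hβt hmt hnt hs
  have hlog : 0 < Real.log (n t) := Real.log_pos (by exact_mod_cast hnt)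
  have hexp := exponent_le_of_sample hk hl (hnN t) (hmM t) hd hlog hs
  have hs0 : 0 ≤ (√(α t) - √(β t)) ^ 2 := sq_nonneg _
  have hmt' : Real.log (n t) ≤ δ / (1 + δ) * (2 * d * M t) := by
    have h2 : (m t : ℝ) = l * M t := by exact_mod_cast hmM t
    rw [Real.norm_of_nonneg hlog.le, Real.norm_of_nonneg (Nat.cast_nonneg _), h2] at hmt
    refine hmt.trans_eq ?_
    field_simp
  have hM0 : (0 : ℝ) < M t := by
    rcases Nat.eq_zero_or_pos (M t) with h0 | h0
    · rw [h0] at hmt'; simp at hmt'; linarith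
    · exact_mod_cast h0
  -- below the threshold `p` is at most of order `log n / m`, hence small
  have hpt : p t ≤ δ / (1 + δ) := by
    have h3 : 2 * (p t * M t * d) ≤ δ / (1 + δ) * (2 * d * M t) := by
      have : 0 ≤ 2 * (N t : ℝ) * (√(α t) - √(β t)) ^ 2 := by positivity
      nlinarith [mul_pos hε hlog]
    refine le_of_mul_le_mul_right (a := 2 * d * M t) ?_ (by positivity)
    linarith
  have hR := exp_le_prod_pow hδ0 (hp t) hpt (M t) h0 h1
  have hρ := exp_le_edgeAffinity hδ0 (hα t) (hβ t) hαt hβt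
  refine ⟨(Real.exp_pos _).trans_le hR, ?_⟩
  have hF := exp_le_pairedAffinity (N := N t) hδ0 hs0 hR hρ
  have hn0 : (0 : ℝ) < n t := by exact_mod_cast (by omega : 0 < n t)
  have hnN' : (N t : ℝ) = n t / k := by
    rw [eq_div_iff hk'.ne', mul_comm]; exact_mod_cast (hnN t).symm
  have hE : Real.exp (-((1 - ε / 2) * Real.log (n t))) ≤
      pairedAffinity (N t) (∏ b, (1 - p t * h b) ^ M t) (edgeAffinity (α t) (β t)) 2 := by
    refine le_trans (Real.exp_le_exp.2 (neg_le_neg ?_)) hF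
    have h5 := mul_le_mul_of_nonneg_left hexp.le (by positivity : 0 ≤ 1 + δ)
    refine h5.trans ?_
    rw [hδ]
    nlinarith [mul_pos (mul_pos hε hε) hlog]
  calc Real.exp (ε / 2 * Real.log (n t)) / k
      = N t * Real.exp (-((1 - ε / 2) * Real.log (n t))) := by
        have : Real.exp (ε / 2 * Real.log (n t)) =
            n t * Real.exp (-((1 - ε / 2) * Real.log (n t))) := by
          nth_rewrite 2 [← Real.exp_log hn0]
          rw [← Real.exp_add]
          congr 1
          ring
        rw [this, hnN']
        ring
    _ ≤ _ := by gcongr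

theorem successBound_anti {G G' ρ : ℝ} (hG : 0 < G) (h : G ≤ G') :
    successBound G' ρ ≤ successBound G ρ := by
  unfold successBound
  gcongr

theorem tendsto_edgeAffinity {α β : ℕ → ℝ} (hα : Tendsto α atTop (𝓝 0))
    (hβ : Tendsto β atTop (𝓝 0)) : Tendsto (fun t => edgeAffinity (α t) (β t)) atTop (𝓝 1) := by
  have h1 := (hα.mul hβ).sqrt
  have h2 := ((hα.const_sub 1).mul (hβ.const_sub 1)).sqrt
  simpa [edgeAffinity] using h1.add h2

theorem tendsto_successBound {k : ℕ} (hk : 0 < k) {n : ℕ → ℕ} (hn : Tendsto n atTop atTop)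
    {α β : ℕ → ℝ} (hα : Tendsto α atTop (𝓝 0)) (hβ : Tendsto β atTop (𝓝 0)) {ε : ℝ}
    (hε : 0 < ε) :
    Tendsto (fun t => successBound (Real.exp (ε / 2 * Real.log (n t)) / k)
      (edgeAffinity (α t) (β t))) atTop (𝓝 0) := by
  have hk' : (0 : ℝ) < k := by exact_mod_cast hk
  have hG : Tendsto (fun t => Real.exp (ε / 2 * Real.log (n t)) / k) atTop atTop := by
    refine Tendsto.atTop_div_const hk' (Real.tendsto_exp_atTop.comp ?_)
    exact (Real.tendsto_log_atTop.comp (tendsto_natCast_atTop_atTop.comp hn)).const_mul_atTop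
      (by positivity)
  have h1 := ((tendsto_pow_atTop (two_ne_zero)).comp hG).const_div_atTop (4 : ℝ)
  have h2 := hG.const_div_atTop (4 : ℝ)
  have h3 := (((tendsto_edgeAffinity hα hβ).pow 8).inv₀ (by norm_num)).sub_const 1
  simpa [successBound] using (h1.add h2).add (h3.const_mul 2)

/-! ### The converse along a sequence of models -/

theorem hellingerSq_nonneg {Z : Type*} [Fintype Z] {P P' : Z → ℝ} (hP : P ∈ stdSimplex ℝ Z)
    (hP' : P' ∈ stdSimplex ℝ Z) : 0 ≤ hellingerSq P P' := by
  rw [hellingerSq_eq]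
  exact sub_nonneg.2 (affinity_le_one hP hP')

theorem hellingerSq_le_one {Z : Type*} [Fintype Z] (P P' : Z → ℝ) : hellingerSq P P' ≤ 1 := by
  rw [hellingerSq_eq]
  linarith [affinity_nonneg P P']

theorem ne_of_sum_hellingerSq_pos {Z : Type*} [Fintype Z] {Q : Z → Z → ℝ}
    (hQ : ∀ u, Q u ∈ stdSimplex ℝ Z) {k : ℕ} {q q' : Fin k → Z}
    (h : 0 < ∑ b, hellingerSq (Q (q b)) (Q (q' b))) : q ≠ q' := by
  rintro rfl
  simp [hellingerSq_self (hQ _)] at h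

theorem edgeAffinity_pos_eventually {α β : ℕ → ℝ} (hα : Tendsto α atTop (𝓝 0))
    (hβ : Tendsto β atTop (𝓝 0)) : ∀ᶠ t in atTop, 0 < edgeAffinity (α t) (β t) :=
  (tendsto_edgeAffinity hα hβ).eventually_const_lt zero_lt_one

/-- If `log n = o(m)` and `n → ∞`, then `m → ∞`. -/
theorem tendsto_of_log_isLittleO {n m : ℕ → ℕ} (hn : Tendsto n atTop atTop)
    (hmn : (fun t => Real.log (n t)) =o[atTop] fun t => (m t : ℝ)) : Tendsto m atTop atTop := by
  rw [← tendsto_natCast_atTop_iff (R := ℝ)]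
  refine tendsto_atTop_mono' _ ?_
    (Real.tendsto_log_atTop.comp (tendsto_natCast_atTop_atTop.comp hn))
  filter_upwards [hmn.bound one_pos] with t ht
  rw [Real.norm_of_nonneg (Nat.cast_nonneg (m t)), one_mul] at ht
  exact (le_abs_self _).trans ht

theorem tendsto_of_tendsto_mul_left {k : ℕ} {n N : ℕ → ℕ} (hk : 0 < k)
    (hnN : ∀ t, n t = k * N t) (hn : Tendsto n atTop atTop) : Tendsto N atTop atTop := by
  refine tendsto_atTop.2 fun b => ?_
  filter_upwards [hn.eventually_ge_atTop (k * b)] with t ht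
  rw [hnN t] at ht
  exact Nat.le_of_mul_le_mul_left ht hk

end TwoGraphMC

theorem theorem2 {Z : Type*} [Fintype Z] {k₁ k₂ : ℕ} (hk₁ : 2 ≤ k₁) (hk₂ : 2 ≤ k₂)
    -- personalization distributions and table of nominal ratings
    (Q : Z → Z → ℝ) (hQ : ∀ u, Q u ∈ stdSimplex ℝ Z)
    (hQmode : ∀ u v, v ≠ u → Q u v < Q u u)
    (z : Fin k₁ → Fin k₂ → Z)
    (hdU : 0 < TwoGraphMC.minUserDisc Q z) (hdI : 0 < TwoGraphMC.minItemDisc Q z)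
    -- numbers of users and items along the sequence of models
    (n m : ℕ → ℕ) (hn : Tendsto n atTop atTop)
    (hk₁n : ∀ t, k₁ ∣ n t) (hk₂m : ∀ t, k₂ ∣ m t)
    (hmn : (fun t => Real.log (n t)) =o[atTop] fun t => (m t : ℝ))
    (hnm : (fun t => Real.log (m t)) =o[atTop] fun t => (n t : ℝ))
    -- sample probability and connection probabilities
    (p α₁ β₁ α₂ β₂ : ℕ → ℝ) (hp : ∀ t, p t ∈ Set.Icc (0 : ℝ) 1)
    (hα₁ : ∀ t, α₁ t ∈ Set.Icc (0 : ℝ) 1) (hβ₁ : ∀ t, β₁ t ∈ Set.Icc (0 : ℝ) 1)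
    (hα₂ : ∀ t, α₂ t ∈ Set.Icc (0 : ℝ) 1) (hβ₂ : ∀ t, β₂ t ∈ Set.Icc (0 : ℝ) 1)
    (hα₁0 : Tendsto α₁ atTop (𝓝 0)) (hβ₁0 : Tendsto β₁ atTop (𝓝 0))
    (hα₂0 : Tendsto α₂ atTop (𝓝 0)) (hβ₂0 : Tendsto β₂ atTop (𝓝 0))
    (ε : ℝ) (hε : 0 < ε)
    (hsample : ∀ᶠ t in atTop, (m t : ℝ) * n t * p t <
      max
        (((1 - ε) / 2 - TwoGraphMC.graphQuality (n t) (α₁ t) (β₁ t) / k₁) *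
            n t * Real.log (n t) / (TwoGraphMC.minUserDisc Q z / k₂))
        (((1 - ε) / 2 - TwoGraphMC.graphQuality (m t) (α₂ t) (β₂ t) / k₂) *
            m t * Real.log (m t) / (TwoGraphMC.minItemDisc Q z / k₁)))
    -- an arbitrary sequence of estimators
    (φ : ∀ t, TwoGraphMC.Estimator (n t) (m t) k₁ k₂ Z) :
    Tendsto (fun t => TwoGraphMC.maxErrorProb (TwoGraphMC.paramSpace (n t) (m t) k₁ k₂ Z)
        Q (p t) (α₁ t) (β₁ t) (α₂ t) (β₂ t) (φ t)) atTop (𝓝 1) ∧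
    Tendsto (fun t => TwoGraphMC.maxErrorProb (TwoGraphMC.paramSpaceOf (n t) (m t) z)
        Q (p t) (α₁ t) (β₁ t) (α₂ t) (β₂ t) (φ t)) atTop (𝓝 1) := by
  have hm : Tendsto m atTop atTop := TwoGraphMC.tendsto_of_log_isLittleO hn hmn
  have hk₁0 : 0 < k₁ := by omega
  have hk₂0 : 0 < k₂ := by omega
  choose N hnN using hk₁n
  choose M hmM using hk₂m
  have hN := TwoGraphMC.tendsto_of_tendsto_mul_left hk₁0 hnN hn
  have hM := TwoGraphMC.tendsto_of_tendsto_mul_left hk₂0 hmM hm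
  obtain ⟨a, a', ha, hda⟩ := TwoGraphMC.exists_minUserDisc hk₁ Q z
  obtain ⟨b, b', hb, hdb⟩ := TwoGraphMC.exists_minUserDisc hk₂ Q fun b a => z a b
  rw [← TwoGraphMC.minItemDisc_eq] at hdb
  rw [← hda] at hdU hsample
  rw [← hdb] at hdI hsample
  have hU := TwoGraphMC.eventually_le_mul_pairedAffinity hk₁0 hk₂0
    (fun _ => TwoGraphMC.hellingerSq_nonneg (hQ _) (hQ _))
    (fun _ => TwoGraphMC.hellingerSq_le_one _ _) hdU hnN hmM hn hmn (fun t => (hp t).1)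
    (fun t => (hα₁ t).1) (fun t => (hβ₁ t).1) hα₁0 hβ₁0 hε
  have hI := TwoGraphMC.eventually_le_mul_pairedAffinity hk₂0 hk₁0
    (fun _ => TwoGraphMC.hellingerSq_nonneg (hQ _) (hQ _))
    (fun _ => TwoGraphMC.hellingerSq_le_one _ _) hdI hmM hnN hm hnm (fun t => (hp t).1)
    (fun t => (hα₂ t).1) (fun t => (hβ₂ t).1) hα₂0 hβ₂0 hε
  have hBU := TwoGraphMC.tendsto_successBound hk₁0 hn hα₁0 hβ₁0 hε
  have hBI := TwoGraphMC.tendsto_successBound hk₂0 hm hα₂0 hβ₂0 hε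
  have hlim := (hBU.max hBI).const_sub 1
  rw [max_self, sub_zero] at hlim
  suffices h : ∀ Θ : ∀ t, Set (TwoGraphMC.Triple (n t) (m t) k₁ k₂ Z),
      (∀ t, TwoGraphMC.paramSpaceOf (n t) (m t) z ⊆ Θ t) →
      Tendsto (fun t => TwoGraphMC.maxErrorProb (Θ t) Q (p t) (α₁ t) (β₁ t) (α₂ t) (β₂ t) (φ t))
        atTop (𝓝 1) from
    ⟨h _ fun t ξ hξ => hξ.1, h _ fun t => subset_rfl⟩
  intro Θ hΘ
  refine tendsto_of_tendsto_of_tendsto_of_le_of_le' hlim tendsto_const_nhds ?_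
    (Eventually.of_forall fun t => TwoGraphMC.maxErrorProb_le_one hQ (hp t) (hα₁ t) (hβ₁ t)
      (hα₂ t) (hβ₂ t) (φ t) (Θ t))
  filter_upwards [hsample, hU, hI, hN.eventually_ge_atTop 2, hM.eventually_ge_atTop 2,
    TwoGraphMC.edgeAffinity_pos_eventually hα₁0 hβ₁0,
    TwoGraphMC.edgeAffinity_pos_eventually hα₂0 hβ₂0] with t ht hUt hIt hNt hMt hρ₁ hρ₂
  have hΘt := hΘ t
  -- `n t` and `m t` become variables, so that they can be replaced by multiples of `k₁` and `k₂`
  generalize φ t = ψ, Θ t = Ω at hΘt ⊢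
  have hnNt := hnN t
  have hmMt := hmM t
  generalize n t = ν, m t = μ at *
  subst hnNt hmMt
  rcases lt_max_iff.1 ht with h | h
  · obtain ⟨hR, hG⟩ := hUt h
    refine (sub_le_sub_left ((TwoGraphMC.successBound_anti (by positivity) hG).trans
      (le_max_left _ _)) 1).trans ?_
    exact TwoGraphMC.one_sub_le_maxErrorProb_user hQ (hp t) (hα₁ t) (hβ₁ t) (hα₂ t) (hβ₂ t) ψ hΘt
      hNt (by omega) hk₂0 ha (TwoGraphMC.ne_of_sum_hellingerSq_pos hQ hdU) hR hρ₁
  · obtain ⟨hR, hG⟩ := hIt (by rwa [mul_comm (((k₁ * N t : ℕ) : ℝ))])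
    refine (sub_le_sub_left ((TwoGraphMC.successBound_anti (by positivity) hG).trans
      (le_max_right _ _)) 1).trans ?_
    exact TwoGraphMC.one_sub_le_maxErrorProb_item hQ (hp t) (hα₁ t) (hβ₁ t) (hα₂ t) (hβ₂ t) ψ hΘt
      (by omega) hMt hk₁0 hb (TwoGraphMC.ne_of_sum_hellingerSq_pos hQ hdI) hR hρ₂
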